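/- Let $\mathfrak g$ be the complex semisimple Lie algebra of type $A_n,B_n,C_n$ ($n\ge 1$) or $D_n$ ($n\ge 2$), with index set $I=\{1,\dots,n\}$, Chevalley generators $e_i,f_i,h_i$ and Cartan matrix $a_{ij}=\alpha_j(h_i)$. The labelling is the standard one: in type $B_n$, $\alpha_n$ is short and $a_{n,n-1}=-2$; in type $C_n$, $\alpha_n$ is long and $a_{n-1,n}=-2$; in type $D_n$, the nodes $n-1$ and $n$ are both joined to $n-2$ and not to each other (so $D_2$ has Cartan matrix $\mathrm{diag}(2,2)$). For $i\in I$ let $L(\Lambda_i)$ be the irreducible highest weight module of highest weight $\Lambda_i$, where $\Lambda_i(h_j)=\delta_{ij}$, with fixed highest weight vector $u_{\Lambda_i}$. For $v\in L(\Lambda_i)$ let $E(v)\in\mathbb C$ be defined by $v=E(v)u_{\Lambda_i}+(\text{lower weight vectors})$, and let $\widehat\omega$ be the anti-involution of $U(\mathfrak g)$ with $e_i\mapsto f_i$, $f_i\mapsto e_i$, $h_i\mapsto h_i$. There is a unique bilinear form on $L(\Lambda_i)$ with $\langle a u_{\Lambda_i},a'u_{\Lambda_i}\rangle=E(\widehat\omega(a)a'u_{\Lambda_i})$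 for all $a,a'\in U(\mathfrak g)$. A lowest weight vector $v_{\Lambda_i}$ with $\langle v_{\Lambda_i},v_{\Lambda_i}\rangle=1$ exists and is unique up to sign. Put $y_j(t)=\exp(tf_j)$ and $F_i^{(n)}(y)=\langle y\,u_{\Lambda_i},v_{\Lambda_i}\rangle$. The coordinates $a_{k,j},\overline a_{k,j}$ below are independent complex numbers. With a suitable choice of the sign of $v_{\Lambda_i}$, depending on the type, $n$, $i$ and the module $L(\Lambda_i)$ with its fixed $u_{\Lambda_i}$ but not on the coordinates, the following identities hold for all $i\in I$ and all values of the coordinates. (i) Type $A_n$. For $$y=\prod_{k=1}^{n}\bigl(y_n(a_{k,n})\,y_{n-1}(a_{k,n-1})\cdots y_k(a_{k,k})\bigr)$$ (here and below the factors are ordered from left to right by increasing $k$), $$F_i^{(n)}(y)=\prod_{k=1}^{i}\prod_{j=k}^{n-i+k}a_{k,j}.$$ (ii) Type $B_n$. For $$y=\prod_{k=1}^{n}\bigl(y_k(a_{k,k})\cdots y_n(a_{k,n})\,y_{n-1}(\overline a_{k,n-1})\cdots y_k(\overline a_{k,k})\bigr)$$ (the factor for $k=n$ being $y_n(a_{n,n})$),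 and with the convention $\overline a_{k,n}=a_{k,n}$, $$F_i^{(n)}(y)=\prod_{1\le k\le i\le j\le n}a_{k,j}\overline a_{k,j}\prod_{1\le k\le j<i}\overline a_{k,j}^{\,2}\quad(i<n),\qquad F_n^{(n)}(y)=\prod_{1\le k\le j\le n}\overline a_{k,j}.$$ (iii) Type $C_n$. For $y$ given by the same expression as in (ii), $$F_i^{(n)}(y)=\prod_{1\le k\le i\le j\le n}a_{k,j}\prod_{1\le k\le i\le j<n}\overline a_{k,j}\prod_{1\le k\le j<i}\overline a_{k,j}^{\,2},$$ where the second product is $1$ if $i=n$. (iv) Type $D_n$. For $$y=\prod_{k=1}^{n-1}\bigl(y_k(a_{k,k})\cdots y_{n-1}(a_{k,n-1})\,y_n(\overline a_{k,n-1})\,y_{n-2}(\overline a_{k,n-2})\cdots y_k(\overline a_{k,k})\bigr)$$ (the factor for $k=n-1$ being $y_{n-1}(a_{n-1,n-1})\,y_n(\overline a_{n-1,n-1})$), $$F_i^{(n)}(y)=\prod_{1\le k\le i\le j<n}a_{k,j}\overline a_{k,j}\prod_{1\le k\le j<i}\overline a_{k,j}^{\,2}\qquad(1\le i\le n-2),$$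 $$F_i^{(n)}(y)=\Bigl(\prod_{1\le k\le j<n-1}\overline a_{k,j}\Bigr)\cdot\begin{cases}a_{1,n-1}\,\overline a_{2,n-1}\,a_{3,n-1}\cdots&\text{if } (i=n-1,\ n\text{ even})\text{ or }(i=n,\ n\text{ odd}),\\ \overline a_{1,n-1}\,a_{2,n-1}\,\overline a_{3,n-1}\cdots&\text{if } (i=n-1,\ n\text{ odd})\text{ or }(i=n,\ n\text{ even}),\end{cases}$$ where each of the two alternating products has $n-1$ factors, so that the last factor is $a_{n-1,n-1}$ if $i=n-1$ and $\overline a_{n-1,n-1}$ if $i=n$. -/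

import Mathlib

noncomputable section

namespace ClassicalCrystal

/-! ### Classical types, Cartan matrices, simple Lie algebras -/

/-- The four classical series `A_n`, `B_n`, `C_n`, `D_n`. -/
inductive ClassicalType
  | A | B | C | D

/-- The index set `I = {1, ..., n}` of the simple roots. -/
abbrev Node (n : ℕ) : Type := {j : ℕ // j ∈ Finset.Icc 1 n}

/-- The entry `a_{i,j} = α_j(h_i)` (`1 ≤ i, j ≤ n`) of the Cartan matrix.
In type `B_n` the last simple root is short (`a_{n,n-1} = -2`), in type `C_n` it is long
(`a_{n-1,n} = -2`). -/
def cartanEntry (X : ClassicalType) (n i j : ℕ) : ℤ :=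
  if i = j then 2 else
  match X with
  | .A => if i + 1 = j ∨ j + 1 = i then -1 else 0
  | .B => if i = n ∧ j + 1 = n then -2 else if i + 1 = j ∨ j + 1 = i then -1 else 0
  | .C => if i + 1 = n ∧ j = n then -2 else if i + 1 = j ∨ j + 1 = i then -1 else 0
  | .D =>
    if (i + 2 = n ∧ j = n) ∨ (i = n ∧ j + 2 = n) then -1
    else if (i + 1 = n ∧ j = n) ∨ (i = n ∧ j + 1 = n) then 0
    else if i + 1 = j ∨ j + 1 = i then -1
    else 0

/-- The Cartan matrix `(a_{i,j})` of the given type and rank. -/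
def cartanMatrix (X : ClassicalType) (n : ℕ) : Matrix (Node n) (Node n) ℤ :=
  Matrix.of fun i j => cartanEntry X n i j

/-- The complex semisimple Lie algebra `𝔤` with the given Cartan matrix: generators
`e_i, f_i, h_i` and the Serre relations. -/
abbrev 𝔤 (X : ClassicalType) (n : ℕ) : Type :=
  Matrix.ToLieAlgebra ℂ (cartanMatrix X n)

variable {X : ClassicalType} {n : ℕ}

/-- The canonical map from the free Lie algebra on the Chevalley generators. -/
def proj (X : ClassicalType) (n : ℕ) :
    FreeLieAlgebra ℂ (CartanMatrix.Generators (Node n)) →ₗ⁅ℂ⁆ 𝔤 X n where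
  toFun x := (LieSubmodule.Quotient.mk x :
    FreeLieAlgebra ℂ (CartanMatrix.Generators (Node n)) ⧸
      CartanMatrix.Relations.toIdeal ℂ (cartanMatrix X n))
  map_add' _ _ := rfl
  map_smul' _ _ := rfl
  map_lie' := rfl

/-- The Chevalley generator `e_i`. -/
def e (X : ClassicalType) {n : ℕ} (i : Node n) : 𝔤 X n := proj X n (FreeLieAlgebra.of ℂ (.E i))

/-- The Chevalley generator `f_i`. -/
def f (X : ClassicalType) {n : ℕ} (i : Node n) : 𝔤 X n := proj X n (FreeLieAlgebra.of ℂ (.F i))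

/-- The simple coroot `h_i`. -/
def h (X : ClassicalType) {n : ℕ} (i : Node n) : 𝔤 X n := proj X n (FreeLieAlgebra.of ℂ (.H i))

lemma proj_eq_zero {x : FreeLieAlgebra ℂ (CartanMatrix.Generators (Node n))}
    (hx : x ∈ CartanMatrix.Relations.toIdeal ℂ (cartanMatrix X n)) : proj X n x = 0 :=
  LieSubmodule.Quotient.mk_eq_zero'.2 hx

/-- A Lie algebra homomorphism out of the free Lie algebra that kills the Serre relations
descends to `𝔤`. -/
def descend {L : Type*} [LieRing L] [LieAlgebra ℂ L]
    (φ : FreeLieAlgebra ℂ (CartanMatrix.Generators (Node n)) →ₗ⁅ℂ⁆ L)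
    (hφ : ∀ x ∈ CartanMatrix.Relations.toSet ℂ (cartanMatrix X n), φ x = 0) :
    𝔤 X n →ₗ⁅ℂ⁆ L :=
  have hle : CartanMatrix.Relations.toIdeal ℂ (cartanMatrix X n) ≤ φ.ker :=
    LieSubmodule.lieSpan_le.2 fun x hx => LieHom.mem_ker.2 (hφ x hx)
  { ((CartanMatrix.Relations.toIdeal ℂ (cartanMatrix X n)).toSubmodule.liftQ
      (φ : FreeLieAlgebra ℂ (CartanMatrix.Generators (Node n)) →ₗ[ℂ] L)
      fun x hx => LieHom.mem_ker.1 (hle hx) : 𝔤 X n →ₗ[ℂ] L) with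
    map_lie' := by
      intro x y
      obtain ⟨x, rfl⟩ := LieSubmodule.Quotient.surjective_mk' _ x
      obtain ⟨y, rfl⟩ := LieSubmodule.Quotient.surjective_mk' _ y
      exact φ.map_lie x y }

lemma descend_proj {L : Type*} [LieRing L] [LieAlgebra ℂ L]
    (φ : FreeLieAlgebra ℂ (CartanMatrix.Generators (Node n)) →ₗ⁅ℂ⁆ L)
    (hφ : ∀ x ∈ CartanMatrix.Relations.toSet ℂ (cartanMatrix X n), φ x = 0)
    (x : FreeLieAlgebra ℂ (CartanMatrix.Generators (Node n))) :
    descend φ hφ (proj X n x) = φ x := rfl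

/-! ### The anti-involution of the enveloping algebra -/

/-- The values `e_i ↦ -f_i`, `f_i ↦ -e_i`, `h_i ↦ -h_i` of the Chevalley involution. -/
def chevalleyGen (X : ClassicalType) (n : ℕ) : CartanMatrix.Generators (Node n) → 𝔤 X n
  | .H i => -h X i
  | .E i => -f X i
  | .F i => -e X i

lemma lie_ad_neg {L : Type*} [LieRing L] [LieAlgebra ℂ L] (x y : L) (m : ℕ)
    (hxy : ((LieAlgebra.ad ℂ L x) ^ m) ⁅x, y⁆ = 0) :
    ((LieAlgebra.ad ℂ L (-x)) ^ m) ⁅-x, -y⁆ = 0 := by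
  rw [map_neg, neg_pow, lie_neg, neg_lie, neg_neg, Module.End.mul_apply, hxy, map_zero]

lemma map_ad_pow {L L' : Type*} [LieRing L] [LieAlgebra ℂ L] [LieRing L'] [LieAlgebra ℂ L']
    (φ : L →ₗ⁅ℂ⁆ L') (x y : L) (m : ℕ) :
    φ (((LieAlgebra.ad ℂ L x) ^ m) y) = ((LieAlgebra.ad ℂ L' (φ x)) ^ m) (φ y) := by
  induction m generalizing y with
  | zero => simp
  | succ m ih => simp [pow_succ, ih]

lemma proj_rel {x : FreeLieAlgebra ℂ (CartanMatrix.Generators (Node n))}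
    (hx : x ∈ CartanMatrix.Relations.toSet ℂ (cartanMatrix X n)) : proj X n x = 0 :=
  proj_eq_zero (LieSubmodule.subset_lieSpan hx)

lemma lie_h_h (i j : Node n) : ⁅h X i, h X j⁆ = 0 := by
  have key := proj_rel (X := X) (x := CartanMatrix.Relations.HH ℂ (i, j))
    (by simp [CartanMatrix.Relations.toSet])
  exact (LieHom.map_lie _ _ _).symm.trans key

lemma lie_e_f_self (i : Node n) : ⁅e X i, f X i⁆ = h X i := by
  have key := proj_rel (X := X) (x := CartanMatrix.Relations.EF ℂ (i, i))
    (by simp [CartanMatrix.Relations.toSet])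
  simp only [CartanMatrix.Relations.EF, Function.uncurry, Function.comp_apply, if_true] at key
  rw [map_sub, LieHom.map_lie, sub_eq_zero] at key
  exact key

lemma lie_e_f_of_ne {i j : Node n} (hij : i ≠ j) : ⁅e X i, f X j⁆ = 0 := by
  have key := proj_rel (X := X) (x := CartanMatrix.Relations.EF ℂ (i, j))
    (by simp [CartanMatrix.Relations.toSet])
  simp only [CartanMatrix.Relations.EF, Function.uncurry, Function.comp_apply, if_neg hij] at key
  rw [LieHom.map_lie] at key
  exact key

lemma lie_h_e (i j : Node n) : ⁅h X i, e X j⁆ = cartanMatrix X n i j • e X j := by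
  have key := proj_rel (X := X) (x := CartanMatrix.Relations.HE ℂ (cartanMatrix X n) (i, j))
    (by simp [CartanMatrix.Relations.toSet])
  simp only [CartanMatrix.Relations.HE, Function.uncurry, Function.comp_apply] at key
  rw [map_sub, LieHom.map_lie, map_zsmul, sub_eq_zero] at key
  exact key

lemma lie_h_f (i j : Node n) : ⁅h X i, f X j⁆ = -(cartanMatrix X n i j • f X j) := by
  have key := proj_rel (X := X) (x := CartanMatrix.Relations.HF ℂ (cartanMatrix X n) (i, j))
    (by simp [CartanMatrix.Relations.toSet])
  simp only [CartanMatrix.Relations.HF, Function.uncurry, Function.comp_apply] at key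
  rw [map_add, LieHom.map_lie, map_zsmul] at key
  exact eq_neg_of_add_eq_zero_left key

lemma serre_e (i j : Node n) :
    ((LieAlgebra.ad ℂ (𝔤 X n) (e X i)) ^ (-cartanMatrix X n i j).toNat) ⁅e X i, e X j⁆ = 0 := by
  have key := proj_rel (X := X) (x := CartanMatrix.Relations.adE ℂ (cartanMatrix X n) (i, j))
    (by simp [CartanMatrix.Relations.toSet])
  simp only [CartanMatrix.Relations.adE, Function.uncurry, Function.comp_apply] at key
  rw [map_ad_pow, LieHom.map_lie] at key
  exact key

lemma serre_f (i j : Node n) :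
    ((LieAlgebra.ad ℂ (𝔤 X n) (f X i)) ^ (-cartanMatrix X n i j).toNat) ⁅f X i, f X j⁆ = 0 := by
  have key := proj_rel (X := X) (x := CartanMatrix.Relations.adF ℂ (cartanMatrix X n) (i, j))
    (by simp [CartanMatrix.Relations.toSet])
  simp only [CartanMatrix.Relations.adF, Function.uncurry, Function.comp_apply] at key
  rw [map_ad_pow, LieHom.map_lie] at key
  exact key

lemma chevalley_rel (x : FreeLieAlgebra ℂ (CartanMatrix.Generators (Node n)))
    (hx : x ∈ CartanMatrix.Relations.toSet ℂ (cartanMatrix X n)) :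
    FreeLieAlgebra.lift ℂ (chevalleyGen X n) x = 0 := by
  have hH (i : Node n) : FreeLieAlgebra.lift ℂ (chevalleyGen X n) (FreeLieAlgebra.of ℂ (.H i)) =
    -h X i := FreeLieAlgebra.lift_of_apply _ _
  have hE (i : Node n) : FreeLieAlgebra.lift ℂ (chevalleyGen X n) (FreeLieAlgebra.of ℂ (.E i)) =
    -f X i := FreeLieAlgebra.lift_of_apply _ _
  have hF (i : Node n) : FreeLieAlgebra.lift ℂ (chevalleyGen X n) (FreeLieAlgebra.of ℂ (.F i)) =
    -e X i := FreeLieAlgebra.lift_of_apply _ _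
  rcases hx with (((((⟨⟨i, j⟩, rfl⟩ | ⟨⟨i, j⟩, rfl⟩) | ⟨⟨i, j⟩, rfl⟩) | ⟨⟨i, j⟩, rfl⟩) |
    ⟨⟨i, j⟩, rfl⟩) | ⟨⟨i, j⟩, rfl⟩)
  · simp only [CartanMatrix.Relations.HH, Function.uncurry, Function.comp_apply]
    rw [LieHom.map_lie, hH, hH, lie_neg, neg_lie, neg_neg, lie_h_h]
  · simp only [CartanMatrix.Relations.EF, Function.uncurry, Function.comp_apply]
    by_cases hij : i = j
    · subst hij
      rw [if_pos rfl, map_sub, LieHom.map_lie, hE, hF, hH, lie_neg, neg_lie, neg_neg, ← lie_skew,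
        lie_e_f_self, sub_self]
    · rw [if_neg hij, LieHom.map_lie, hE, hF, lie_neg, neg_lie, neg_neg, ← lie_skew,
        lie_e_f_of_ne (Ne.symm hij), neg_zero]
  · simp only [CartanMatrix.Relations.HE, Function.uncurry, Function.comp_apply]
    rw [map_sub, LieHom.map_lie, map_zsmul, hH, hE, lie_neg, neg_lie, neg_neg, lie_h_f, smul_neg,
      sub_self]
  · simp only [CartanMatrix.Relations.HF, Function.uncurry, Function.comp_apply]
    rw [map_add, LieHom.map_lie, map_zsmul, hH, hF, lie_neg, neg_lie, neg_neg, lie_h_e, smul_neg,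
      add_neg_cancel]
  · simp only [CartanMatrix.Relations.adE, Function.uncurry, Function.comp_apply]
    rw [map_ad_pow, LieHom.map_lie, hE, hE]
    exact lie_ad_neg _ _ _ (serre_f i j)
  · simp only [CartanMatrix.Relations.adF, Function.uncurry, Function.comp_apply]
    rw [map_ad_pow, LieHom.map_lie, hF, hF]
    exact lie_ad_neg _ _ _ (serre_e i j)

/-- The Chevalley involution `e_i ↦ -f_i`, `f_i ↦ -e_i`, `h_i ↦ -h_i` of `𝔤`. -/
def chevalley (X : ClassicalType) (n : ℕ) : 𝔤 X n →ₗ⁅ℂ⁆ 𝔤 X n :=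
  descend (FreeLieAlgebra.lift ℂ (chevalleyGen X n)) chevalley_rel

lemma chevalley_e (i : Node n) : chevalley X n (e X i) = -f X i := FreeLieAlgebra.lift_of_apply _ _

lemma chevalley_f (i : Node n) : chevalley X n (f X i) = -e X i := FreeLieAlgebra.lift_of_apply _ _

lemma chevalley_h (i : Node n) : chevalley X n (h X i) = -h X i := FreeLieAlgebra.lift_of_apply _ _

/-- The universal enveloping algebra `U(𝔤)`. -/
abbrev U (X : ClassicalType) (n : ℕ) : Type := UniversalEnvelopingAlgebra ℂ (𝔤 X n)

attribute [local instance 100] LieRing.ofAssociativeRing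

/-- The anti-homomorphism `x ↦ -θ(x)` (`θ` the Chevalley involution), with values in the opposite
of the enveloping algebra. -/
def antiInvolutionLie (X : ClassicalType) (n : ℕ) : 𝔤 X n →ₗ⁅ℂ⁆ (U X n)ᵐᵒᵖ where
  toFun x := MulOpposite.op (-(UniversalEnvelopingAlgebra.ι ℂ (chevalley X n x)))
  map_add' x y := by rw [map_add, map_add, neg_add, MulOpposite.op_add]
  map_smul' c x := by rw [map_smul, map_smul, ← smul_neg, MulOpposite.op_smul, RingHom.id_apply]
  map_lie' := by
    intro x y
    apply MulOpposite.unop_injective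
    rw [LieHom.map_lie, LieHom.map_lie, LieRing.of_associative_ring_bracket,
      LieRing.of_associative_ring_bracket]
    simp only [MulOpposite.unop_op, MulOpposite.unop_sub, MulOpposite.unop_mul, neg_mul_neg,
      neg_sub]

/-- The anti-involution `ω̂` of `U(𝔤)` with `ω̂(e_i) = f_i`, `ω̂(f_i) = e_i`, `ω̂(h_i) = h_i`
(see the lemmas below). -/
def omega (a : U X n) : U X n :=
  (UniversalEnvelopingAlgebra.lift ℂ (antiInvolutionLie X n) a).unop

lemma omega_mul (a b : U X n) : omega (a * b) = omega b * omega a := by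
  rw [omega, map_mul, MulOpposite.unop_mul, omega, omega]

lemma omega_ι (x : 𝔤 X n) : omega (UniversalEnvelopingAlgebra.ι ℂ x) =
    -(UniversalEnvelopingAlgebra.ι ℂ (chevalley X n x)) := by
  rw [omega, UniversalEnvelopingAlgebra.lift_ι_apply]
  rfl

lemma omega_e (i : Node n) :
    omega (UniversalEnvelopingAlgebra.ι ℂ (e X i)) =
      UniversalEnvelopingAlgebra.ι ℂ (f X i) := by
  rw [omega_ι, chevalley_e, map_neg, neg_neg]

lemma omega_f (i : Node n) :
    omega (UniversalEnvelopingAlgebra.ι ℂ (f X i)) =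
      UniversalEnvelopingAlgebra.ι ℂ (e X i) := by
  rw [omega_ι, chevalley_f, map_neg, neg_neg]

lemma omega_h (i : Node n) :
    omega (UniversalEnvelopingAlgebra.ι ℂ (h X i)) =
      UniversalEnvelopingAlgebra.ι ℂ (h X i) := by
  rw [omega_ι, chevalley_h, map_neg, neg_neg]

/-! ### Highest weight modules and the invariant bilinear form -/

/-- The action of the enveloping algebra on a `𝔤`-module. -/
def act {V : Type*} [AddCommGroup V]
    [Module ℂ V] [LieRingModule (𝔤 X n) V] [LieModule ℂ (𝔤 X n) V]
    (a : U X n) : Module.End ℂ V :=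
  UniversalEnvelopingAlgebra.lift ℂ (LieModule.toEnd ℂ (𝔤 X n) V) a

/-- `v` lies in the weight space of weight `μ`; a weight is given by its values `μ(h_i)`. -/
def HasWeight (X : ClassicalType) (μ : Node n → ℂ) {V : Type*} [AddCommGroup V] [Module ℂ V]
    [LieRingModule (𝔤 X n) V] (v : V) : Prop :=
  ∀ i, ⁅h X i, v⁆ = μ i • v

/-- `u` is a highest weight vector of weight `μ`. An irreducible module with such a vector is
(a realization of) the irreducible highest weight module `L(μ)`. -/
structure IsHighestWeightVector (X : ClassicalType) (μ : Node n → ℂ) {V : Type*}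
    [AddCommGroup V] [Module ℂ V] [LieRingModule (𝔤 X n) V] (u : V) : Prop where
  ne_zero : u ≠ 0
  weight : HasWeight X μ u
  e_eq_zero : ∀ i : Node n, ⁅e X i, u⁆ = 0

/-- `v` is a lowest weight vector. -/
structure IsLowestWeightVector (X : ClassicalType) (n : ℕ) {V : Type*}
    [AddCommGroup V] [Module ℂ V] [LieRingModule (𝔤 X n) V] (v : V) : Prop where
  ne_zero : v ≠ 0
  weight : ∃ μ : Node n → ℂ, HasWeight X μ v
  f_eq_zero : ∀ i : Node n, ⁅f X i, v⁆ = 0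

/-- The fundamental weight `Λ_i`: `Λ_i(h_j) = δ_{i,j}`. -/
def fundamentalWeight (i : Node n) : Node n → ℂ := Pi.single i 1

/-- The weight `μ - ∑ j, m_j α_j`. -/
def lowerWeight (X : ClassicalType) (μ : Node n → ℂ) (m : Node n → ℕ) : Node n → ℂ :=
  fun i => μ i - ∑ j, (m j : ℂ) * (cartanMatrix X n i j : ℂ)

/-- The span of all weight vectors whose weight is lower than `μ`, i.e. of the form
`μ - ∑ j, m_j α_j` with `m_j ∈ ℕ` not all zero. -/
def lowerSpan (X : ClassicalType) (μ : Node n → ℂ) (V : Type*) [AddCommGroup V] [Module ℂ V]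
    [LieRingModule (𝔤 X n) V] : Submodule ℂ V :=
  Submodule.span ℂ {v | ∃ m : Node n → ℕ, m ≠ 0 ∧ HasWeight X (lowerWeight X μ m) v}

/-- `c` is the expectation value `E(v)`: `v = c u + (lower weight vectors)`. -/
def IsExpectation (X : ClassicalType) (μ : Node n → ℂ) {V : Type*} [AddCommGroup V] [Module ℂ V]
    [LieRingModule (𝔤 X n) V] (u v : V) (c : ℂ) : Prop :=
  v - c • u ∈ lowerSpan X μ V

/-- `B` is the bilinear form of the highest weight module with highest weight vector `u` of
weight `μ`: `B(a u, a' u) = E(ω̂(a) a' u)` for all `a, a'` in the enveloping algebra. -/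
def IsInvariantForm (X : ClassicalType) (μ : Node n → ℂ) {V : Type*} [AddCommGroup V]
    [Module ℂ V] [LieRingModule (𝔤 X n) V] [LieModule ℂ (𝔤 X n) V]
    (u : V) (B : LinearMap.BilinForm ℂ V) : Prop :=
  ∀ a a' : U X n, IsExpectation X μ u (act (omega a * a') u) (B (act a u) (act a' u))

/-! ### The action of the unipotent group -/

/-- `exp(t x) v = ∑ k, t^k / k! x^k v` for `x ∈ 𝔤` acting locally nilpotently on `V`
(so that the sum is finite). -/
def expAct {V : Type*} [AddCommGroup V]
    [Module ℂ V] [LieRingModule (𝔤 X n) V] [LieModule ℂ (𝔤 X n) V]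
    (x : 𝔤 X n) (t : ℂ) (v : V) : V :=
  ∑ᶠ k : ℕ, (t ^ k / (k.factorial : ℂ)) • ((LieModule.toEnd ℂ (𝔤 X n) V x) ^ k) v

/-- The action of `y_i(t) = exp(t f_i)`. The label `i` is a natural number; only labels
`1 ≤ i ≤ n` are meaningful and used. -/
def y (X : ClassicalType) (n i : ℕ) (t : ℂ) {V : Type*} [AddCommGroup V] [Module ℂ V]
    [LieRingModule (𝔤 X n) V] [LieModule ℂ (𝔤 X n) V] (v : V) : V :=
  expAct (X := X) (n := n) (if hi : i ∈ Finset.Icc 1 n then f X ⟨i, hi⟩ else 0) t v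

/-- The action of the product `y_{i_1}(c_1) ⋯ y_{i_N}(c_N)` encoded by the list
`[(i_1, c_1), ..., (i_N, c_N)]`. -/
def yWord (X : ClassicalType) (n : ℕ) (w : List (ℕ × ℂ)) {V : Type*} [AddCommGroup V]
    [Module ℂ V] [LieRingModule (𝔤 X n) V] [LieModule ℂ (𝔤 X n) V] (v : V) : V :=
  w.foldr (fun p v => y X n p.1 p.2 v) v

/-- `v` is a lowest weight vector with `⟨v, v⟩ = 1`. -/
def IsNormalizedLowest (X : ClassicalType) (n : ℕ) {V : Type*}
    [AddCommGroup V] [Module ℂ V] [LieRingModule (𝔤 X n) V]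
    (B : LinearMap.BilinForm ℂ V) (v : V) : Prop :=
  IsLowestWeightVector X n v ∧ B v v = 1

/-! ### The longest words and the monomials -/

/-- The increasing list `[k, k + 1, ..., m]` (empty if `m < k`). -/
def upTo (k m : ℕ) : List ℕ := List.range' k (m + 1 - k)

/-- The element `y_{ι₀}(a)` for the chosen reduced longest word `ι₀`, as a list of pairs
(label, coordinate). Here `a k j` stands for `a_{k,j}` and `b k j` for `ā_{k,j}`.

* `A_n`: `(y_n(a_{1,n}) ⋯ y_1(a_{1,1})) (y_n(a_{2,n}) ⋯ y_2(a_{2,2})) ⋯ y_n(a_{n,n})`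
* `B_n`, `C_n`: the product over `k = 1, ..., n` of
  `y_k(a_{k,k}) ⋯ y_n(a_{k,n}) y_{n-1}(ā_{k,n-1}) ⋯ y_k(ā_{k,k})`
* `D_n`: the product over `k = 1, ..., n-1` of
  `y_k(a_{k,k}) ⋯ y_{n-1}(a_{k,n-1}) y_n(ā_{k,n-1}) y_{n-2}(ā_{k,n-2}) ⋯ y_k(ā_{k,k})` -/
def longestWord (X : ClassicalType) (n : ℕ) (a b : ℕ → ℕ → ℂ) : List (ℕ × ℂ) :=
  match X with
  | .A => (upTo 1 n).flatMap fun k => (upTo k n).reverse.map fun j => (j, a k j)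
  | .B | .C => (upTo 1 n).flatMap fun k =>
      ((upTo k n).map fun j => (j, a k j)) ++ (upTo k (n - 1)).reverse.map fun j => (j, b k j)
  | .D => (upTo 1 (n - 1)).flatMap fun k =>
      ((upTo k (n - 1)).map fun j => (j, a k j)) ++ [(n, b k (n - 1))] ++
        (upTo k (n - 2)).reverse.map fun j => (j, b k j)

open Finset in
/-- The monomial that equals `F_i^{(n)}(y_{ι₀}(a))`. -/
def monomial (X : ClassicalType) (n i : ℕ) (a b : ℕ → ℕ → ℂ) : ℂ :=
  match X with
  | .A => ∏ k ∈ Icc 1 i, ∏ j ∈ Icc k (n - i + k), a k j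
  | .B =>
      -- the convention `ā_{k,n} = a_{k,n}`
      let b' : ℕ → ℕ → ℂ := fun k j => if j = n then a k n else b k j
      if i < n then
        (∏ k ∈ Icc 1 i, ∏ j ∈ Icc i n, a k j * b' k j) *
          ∏ k ∈ Ico 1 i, ∏ j ∈ Ico k i, b' k j ^ 2
      else ∏ k ∈ Icc 1 n, ∏ j ∈ Icc k n, b' k j
  | .C =>
      (∏ k ∈ Icc 1 i, ∏ j ∈ Icc i n, a k j) * (∏ k ∈ Icc 1 i, ∏ j ∈ Ico i n, b k j) *
        ∏ k ∈ Ico 1 i, ∏ j ∈ Ico k i, b k j ^ 2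
  | .D =>
      if i + 2 ≤ n then
        (∏ k ∈ Icc 1 i, ∏ j ∈ Ico i n, a k j * b k j) *
          ∏ k ∈ Ico 1 i, ∏ j ∈ Ico k i, b k j ^ 2
      else if (i + 1 = n ∧ Even n) ∨ (i = n ∧ Odd n) then
        -- `a_{1,n-1} ā_{2,n-1} a_{3,n-1} ⋯`
        (∏ k ∈ Ico 1 (n - 1), ∏ j ∈ Ico k (n - 1), b k j) *
          ∏ k ∈ Ico 1 n, if Odd k then a k (n - 1) else b k (n - 1)
      else
        -- `ā_{1,n-1} a_{2,n-1} ā_{3,n-1} ⋯`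
        (∏ k ∈ Ico 1 (n - 1), ∏ j ∈ Ico k (n - 1), b k j) *
          ∏ k ∈ Ico 1 n, if Odd k then b k (n - 1) else a k (n - 1)

end ClassicalCrystal

end

/-! Read the word from the right. Each letter y_j(c) is matched with the simple reflection s_j. The
weight Λ_i then runs through extremal weights, and u through extremal vectors: a letter with label j
sends v to v' = f_j^p v / p!, where p ≥ 0 is the value at h_j of the current weight. Let z be the
part of the product already applied to u. The invariant is that z lies in the span of all e-words
applied to v (`wordSpan e v`), so z only has weights ≥ wt(v).

In ⟨exp(c f_j) z, v'⟩ only one term of the exponential survives. By contravariance, f_j^k z pairs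
with v' as z pairs with e_j^k v'. For k < p this vanishes because the weight of e_j^k v' is too low.
For k > p it vanishes because e_j^p v' = p! v and e_j v = 0. The term k = p gives c^p ⟨z, v⟩. Hence
the whole pairing is the monomial ∏ c^p (`IsExtremal.exp_apply_reflect`,
`HighestWeightRep.exp_word_apply`). The same computation gives ⟨v', v'⟩ = ⟨v, v⟩. If the path ends
at an antidominant weight, the last extremal vector is therefore a normalized lowest weight vector.

Extremality is controlled by a norm rather than by the Weyl group. No weight of the module is longer
than the highest weight (`HighestWeightRep.normDrop_nonneg`), and reflections preserve length. So a
vector of maximal length is killed by e_j when its weight is ≥ 0 at h_j, and by f_j when it is ≤ 0.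
Finite dimensionality is never assumed: local nilpotence of the f_j follows from the Serre relations
and f_j^{λ(h_j)+1} u = 0.

The form exists because E(ω̂(a) u) = E(a u) (`expectation_omega`), which is proved modulo a left
ideal instead of through a triangular decomposition of U(𝔤).

What remains is to compute the exponents p. In orthogonal coordinates a block of the longest word
carries one coordinate through the others (type A), or out to the end, through a sign change, and
back (types B, C, D). The exponents are then sums and differences of coordinates of Λ_i
(`coordPath_genWord_A`, `coordPath_genWord_BC`, `coordPath_genWord_D`), and they are compared with
the stated monomials in `hasMonomialPath`. -/

noncomputable section

namespace ClassicalCrystal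

/-! ### Families of operators satisfying the Chevalley relations -/

section Operators

variable {I V : Type*} [Fintype I] [DecidableEq I] [AddCommGroup V] [Module ℂ V]

/-- The operators `e_i, f_i, h_i` satisfy the Chevalley relations (without the Serre relations)
with respect to the matrix `A`. -/
structure ChevalleyRep (A : Matrix I I ℤ) (e f h : I → Module.End ℂ V) : Prop where
  h_h : ∀ i j, Commute (h i) (h j)
  e_f : ∀ i j x, e i (f j x) = f j (e i x) + if i = j then h i x else 0
  h_e : ∀ i j x, h i (e j x) = e j (h i x) + (A i j : ℂ) • e j x
  h_f : ∀ i j x, h i (f j x) = f j (h i x) - (A i j : ℂ) • f j x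

/-- `x` is a simultaneous eigenvector of the `h_i` with eigenvalues `μ_i`, or zero. -/
def IsWt (h : I → Module.End ℂ V) (μ : I → ℂ) (x : V) : Prop := ∀ i, h i x = μ i • x

/-- The weight `μ + ∑ j, m_j α_j`. -/
def shift (A : Matrix I I ℤ) (μ : I → ℂ) (m : I → ℤ) : I → ℂ :=
  fun i => μ i + ∑ j, (A i j : ℂ) * (m j : ℂ)

/-- The span of all words in the operators `e_i` applied to `v`. -/
def wordSpan (e : I → Module.End ℂ V) (v : V) : Submodule ℂ V :=
  Submodule.span ℂ (Set.range fun l : List I => (l.map e).prod v)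

variable {A : Matrix I I ℤ} {e f h : I → Module.End ℂ V} {μ ν : I → ℂ} {u v x y z : V}

omit [Fintype I] in
lemma ChevalleyRep.swap (R : ChevalleyRep A e f h) : ChevalleyRep A f e (fun i => -h i) where
  h_h i j := ((R.h_h i j).neg_left).neg_right
  e_f i j x := by
    rw [R.e_f j i x]
    by_cases hij : i = j
    · subst hij; simp
    · simp [hij, Ne.symm hij]
  h_e i j x := by simp [R.h_f]; abel
  h_f i j x := by simp [R.h_e]; abel

omit [DecidableEq I] in
lemma shift_zero : shift A μ 0 = μ := by ext i; simp [shift]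

omit [DecidableEq I] in
lemma shift_shift (m m' : I → ℤ) : shift A (shift A μ m) m' = shift A μ (m + m') := by
  ext i; simp [shift, mul_add, Finset.sum_add_distrib, add_assoc]

omit [DecidableEq I] in
lemma shift_neg (m : I → ℤ) : shift A (-μ) m = -shift A μ (-m) := by
  ext i; simp [shift]; ring

lemma shift_single (j : I) (k : ℤ) (i : I) :
    shift A μ (Pi.single j k) i = μ i + (A i j : ℂ) * k := by
  simp only [shift, Pi.single_apply]
  rw [Finset.sum_eq_single j] <;> simp +contextual

omit [DecidableEq I] in
lemma shift_injective (hA : ∀ m : I → ℤ, (∀ i, ∑ j, A i j * m j = 0) → m = 0) {m m' : I → ℤ}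
    (hm : shift A μ m = shift A μ m') : m = m' := by
  refine sub_eq_zero.1 (hA _ fun i => ?_)
  have h1 := congrFun hm i
  simp only [shift, add_right_inj] at h1
  simp only [Pi.sub_apply, mul_sub, Finset.sum_sub_distrib, sub_eq_zero]
  exact_mod_cast h1

section
omit [Fintype I] [DecidableEq I]

lemma isWt_neg : IsWt (fun i => -h i) (-μ) x ↔ IsWt h μ x := by
  simp [IsWt]

lemma IsWt.smul (hx : IsWt h μ x) (c : ℂ) : IsWt h μ (c • x) := fun i => by
  rw [map_smul, hx i, smul_comm]

lemma IsWt.sub (hx : IsWt h μ x) (hy : IsWt h μ y) : IsWt h μ (x - y) := fun i => by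
  rw [map_sub, hx i, hy i, smul_sub]

end

lemma IsWt.raise (R : ChevalleyRep A e f h) (hx : IsWt h μ x) (j : I) :
    IsWt h (shift A μ (Pi.single j 1)) (e j x) := fun i => by
  rw [R.h_e, hx i, shift_single, map_smul, add_smul]; simp

lemma IsWt.raise_pow (R : ChevalleyRep A e f h) (hx : IsWt h μ x) (j : I) (k : ℕ) :
    IsWt h (shift A μ (Pi.single j (k : ℤ))) ((e j ^ k) x) := by
  induction k with
  | zero => simpa [shift_zero] using hx
  | succ k ih =>
    have h1 := ih.raise R j
    rw [shift_shift, ← Pi.single_add] at h1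
    rw [pow_succ', Module.End.mul_apply]
    exact_mod_cast h1

lemma IsWt.lower_pow (R : ChevalleyRep A e f h) (hx : IsWt h μ x) (j : I) (k : ℕ) :
    IsWt h (shift A μ (Pi.single j (-(k : ℤ)))) ((f j ^ k) x) := by
  have h1 := (isWt_neg.2 hx).raise_pow R.swap j k
  rwa [shift_neg, isWt_neg, ← Pi.single_neg] at h1

lemma IsWt.lower (R : ChevalleyRep A e f h) (hx : IsWt h μ x) (j : I) :
    IsWt h (shift A μ (Pi.single j (-1))) (f j x) := by
  simpa using hx.lower_pow R j 1

omit [Fintype I] in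
-- Simultaneous eigenspaces of commuting operators are independent; they lie in the generalized
-- ones, for which independence is available. This is the only way in which weights are separated
-- below.
lemma ChevalleyRep.eq_zero_of_mem_span (R : ChevalleyRep A e f h) {S : (I → ℂ) → Prop}
    (hx : IsWt h μ x) (hμ : ¬ S μ)
    (hS : x ∈ Submodule.span ℂ {z | ∃ ν, S ν ∧ IsWt h ν z}) : x = 0 := by
  have hi := Module.End.independent_iInf_maxGenEigenspace_of_forall_mapsTo h fun i j φ =>
    Module.End.mapsTo_maxGenEigenspace_of_comm (R.h_h j i) φ
  have key (ν : I → ℂ) (z : V) (hz : IsWt h ν z) :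
      z ∈ ⨅ i, (h i).maxGenEigenspace (ν i) := by
    rw [Module.End.mem_iInf_maxGenEigenspace_iff]
    intro j
    exact ⟨1, by simp [hz j]⟩
  refine Submodule.disjoint_def.1 (hi μ) x (key μ x hx) ?_
  refine Submodule.span_le.2 ?_ hS
  rintro z ⟨ν, hν, hz⟩
  exact Submodule.mem_iSup_of_mem ν (Submodule.mem_iSup_of_mem (fun hh => hμ (hh ▸ hν)) (key ν z hz))

omit [Fintype I] in
lemma ChevalleyRep.weight_mem (R : ChevalleyRep A e f h) {S : (I → ℂ) → Prop}
    (hx : IsWt h μ x) (h0 : x ≠ 0)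
    (hS : x ∈ Submodule.span ℂ {z | ∃ ν, S ν ∧ IsWt h ν z}) : S μ := by
  by_contra hμ
  exact h0 (R.eq_zero_of_mem_span hx hμ hS)

/-! ### Subspaces spanned by words in the raising operators -/

section WordSpan
omit [Fintype I] [DecidableEq I]

lemma self_mem_wordSpan : v ∈ wordSpan e v := Submodule.subset_span ⟨[], by simp⟩

lemma apply_mem_wordSpan (hx : x ∈ wordSpan e v) (j : I) : e j x ∈ wordSpan e v := by
  refine (Submodule.span_le.2 ?_ : wordSpan e v ≤ (wordSpan e v).comap (e j)) hx
  rintro _ ⟨l, rfl⟩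
  exact Submodule.subset_span ⟨j :: l, by simp⟩

lemma wordSpan_le {P : Submodule ℂ V} (hv : v ∈ P) (hP : ∀ j x, x ∈ P → e j x ∈ P) :
    wordSpan e v ≤ P := by
  refine Submodule.span_le.2 ?_
  rintro _ ⟨l, rfl⟩
  induction l with
  | nil => simpa using hv
  | cons j l ih => simpa using hP j _ ih

lemma apply_mem_wordSpan_sup {J : Submodule ℂ V} (hJ : ∀ j x, x ∈ J → e j x ∈ J)
    (hx : x ∈ wordSpan e v ⊔ J) (j : I) : e j x ∈ wordSpan e v ⊔ J := by
  obtain ⟨y, hy, z, hz, rfl⟩ := Submodule.mem_sup.1 hx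
  rw [map_add]
  exact Submodule.add_mem_sup (apply_mem_wordSpan hy j) (hJ j z hz)

lemma pow_apply_mem {P : Submodule ℂ V} {g : Module.End ℂ V} (hP : ∀ x ∈ P, g x ∈ P) (hx : x ∈ P)
    (k : ℕ) : (g ^ k) x ∈ P := by
  induction k with
  | zero => simpa using hx
  | succ k ih => rw [pow_succ', Module.End.mul_apply]; exact hP _ ih

end WordSpan

omit [Fintype I] in
-- Moving `h j` past `e i` only costs a multiple of `e i`. The summand `J` is zero for modules; it
-- is a left ideal in the enveloping algebra, where the vector 1 is a weight vector only modulo that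
-- ideal.
lemma ChevalleyRep.h_mem_wordSpan_sup (R : ChevalleyRep A e f h) {J : Submodule ℂ V}
    (hJe : ∀ j x, x ∈ J → e j x ∈ J) (hJh : ∀ j x, x ∈ J → h j x ∈ J)
    (hv : ∀ j, h j v ∈ wordSpan e v ⊔ J) (j : I) (hx : x ∈ wordSpan e v ⊔ J) :
    h j x ∈ wordSpan e v ⊔ J := by
  set P := wordSpan e v ⊔ J
  have h1 : wordSpan e v ≤ P ⊓ P.comap (h j) := by
    refine wordSpan_le ⟨Submodule.mem_sup_left self_mem_wordSpan, hv j⟩ ?_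
    rintro i x ⟨hx, hx'⟩
    refine ⟨apply_mem_wordSpan_sup hJe hx i, ?_⟩
    change h j (e i x) ∈ P
    rw [R.h_e]
    exact P.add_mem (apply_mem_wordSpan_sup hJe hx' i)
      (P.smul_mem _ (apply_mem_wordSpan_sup hJe hx i))
  have h2 : P ≤ P.comap (h j) :=
    sup_le (h1.trans inf_le_right) fun x hx => Submodule.mem_sup_right (hJh j x hx)
  exact h2 hx

omit [Fintype I] in
lemma ChevalleyRep.f_mem_wordSpan_sup (R : ChevalleyRep A e f h) {J : Submodule ℂ V}
    (hJe : ∀ j x, x ∈ J → e j x ∈ J) (hJh : ∀ j x, x ∈ J → h j x ∈ J)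
    (hv : ∀ j, h j v ∈ wordSpan e v ⊔ J) (j : I) (hJf : ∀ x, x ∈ J → f j x ∈ J)
    (hfv : f j v ∈ wordSpan e v ⊔ J) (hx : x ∈ wordSpan e v ⊔ J) :
    f j x ∈ wordSpan e v ⊔ J := by
  set P := wordSpan e v ⊔ J
  have h1 : wordSpan e v ≤ P ⊓ P.comap (f j) := by
    refine wordSpan_le ⟨Submodule.mem_sup_left self_mem_wordSpan, hfv⟩ ?_
    rintro i x ⟨hx, hx'⟩
    refine ⟨apply_mem_wordSpan_sup hJe hx i, ?_⟩
    change f j (e i x) ∈ P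
    rw [eq_sub_of_add_eq (R.e_f i j x).symm]
    refine P.sub_mem (apply_mem_wordSpan_sup hJe hx' i) ?_
    split_ifs
    · exact R.h_mem_wordSpan_sup hJe hJh hv i hx
    · exact P.zero_mem
  have h2 : P ≤ P.comap (f j) :=
    sup_le (h1.trans inf_le_right) fun x hx => Submodule.mem_sup_right (hJf x hx)
  exact h2 hx

omit [Fintype I] in
lemma ChevalleyRep.h_mem_wordSpan (R : ChevalleyRep A e f h) (hv : IsWt h μ v) (j : I)
    (hx : x ∈ wordSpan e v) : h j x ∈ wordSpan e v := by
  have := R.h_mem_wordSpan_sup (J := ⊥) (v := v) (x := x) (by simp) (by simp)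
    (fun j => by rw [hv j, sup_bot_eq]; exact Submodule.smul_mem _ _ self_mem_wordSpan) j
  rw [sup_bot_eq] at this
  exact this hx

omit [Fintype I] in
lemma ChevalleyRep.f_mem_wordSpan (R : ChevalleyRep A e f h) (hv : IsWt h μ v) (j : I)
    (hfv : f j v ∈ wordSpan e v) (hx : x ∈ wordSpan e v) : f j x ∈ wordSpan e v := by
  have := R.f_mem_wordSpan_sup (J := ⊥) (v := v) (x := x) (by simp) (by simp)
    (fun j => by rw [hv j, sup_bot_eq]; exact Submodule.smul_mem _ _ self_mem_wordSpan) j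
    (by simp)
  rw [sup_bot_eq] at this
  exact this hfv hx

lemma ChevalleyRep.e_mem_of_mem_sup (R : ChevalleyRep A e f h) (hv : IsWt h μ v) (j : I)
    (hx : x ∈ Submodule.span ℂ {v} ⊔ Submodule.span ℂ
      {z | ∃ ν, (∃ m : I → ℕ, m ≠ 0 ∧ ν = shift A μ (fun i => m i)) ∧ IsWt h ν z}) :
    e j x ∈ Submodule.span ℂ
      {z | ∃ ν, (∃ m : I → ℕ, m ≠ 0 ∧ ν = shift A μ (fun i => m i)) ∧ IsWt h ν z} := by
  set S := Submodule.span ℂ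
      {z | ∃ ν, (∃ m : I → ℕ, m ≠ 0 ∧ ν = shift A μ (fun i => m i)) ∧ IsWt h ν z}
  refine (sup_le ?_ ?_ : Submodule.span ℂ {v} ⊔ S ≤ S.comap (e j)) hx
  · rw [Submodule.span_singleton_le_iff_mem]
    refine Submodule.subset_span ⟨_, ⟨Pi.single j 1, by simp, ?_⟩, hv.raise R j⟩
    congr 1; ext i; by_cases hij : i = j
    · subst hij; simp
    · simp [hij]
  · refine Submodule.span_le.2 ?_
    rintro z ⟨ν, ⟨m, hm, rfl⟩, hz⟩
    refine Submodule.subset_span ⟨_, ⟨m + Pi.single j 1, ?_, ?_⟩, hz.raise R j⟩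
    · intro h0
      have := congrFun h0 j
      simp at this
    · rw [shift_shift]
      congr 1; ext i; by_cases hij : i = j
      · subst hij; simp
      · simp [hij]

/-- The empty word gives `v` and every other word has strictly higher weight, so the weight of `v`
has multiplicity one in the span. -/
lemma ChevalleyRep.wordSpan_le_sup (R : ChevalleyRep A e f h) (hv : IsWt h μ v) :
    wordSpan e v ≤ Submodule.span ℂ {v} ⊔ Submodule.span ℂ
      {z | ∃ ν, (∃ m : I → ℕ, m ≠ 0 ∧ ν = shift A μ (fun i => m i)) ∧ IsWt h ν z} :=
  wordSpan_le (Submodule.mem_sup_left (Submodule.mem_span_singleton_self v))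
    fun j _ hx => Submodule.mem_sup_right (R.e_mem_of_mem_sup hv j hx)

lemma ChevalleyRep.wordSpan_le_span (R : ChevalleyRep A e f h) (hv : IsWt h μ v) :
    wordSpan e v ≤ Submodule.span ℂ
      {z | ∃ ν, (∃ m : I → ℕ, ν = shift A μ (fun i => m i)) ∧ IsWt h ν z} := by
  refine (R.wordSpan_le_sup hv).trans (sup_le ?_ (Submodule.span_mono ?_))
  · rw [Submodule.span_singleton_le_iff_mem]
    refine Submodule.subset_span ⟨μ, ⟨0, ?_⟩, hv⟩
    exact (shift_zero (A := A) (μ := μ)).symm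
  · rintro z ⟨ν, ⟨m, -, hm⟩, hz⟩
    exact ⟨ν, ⟨m, hm⟩, hz⟩

/-! ### Strings for a simple root -/

omit [Fintype I] in
lemma ChevalleyRep.e_f_pow_succ (R : ChevalleyRep A e f h) (hA : ∀ i, A i i = 2) {i : I} {c : ℂ}
    (he : e i v = 0) (hh : h i v = c • v) (k : ℕ) :
    e i ((f i ^ (k + 1)) v) = ((k + 1) * (c - k) : ℂ) • (f i ^ k) v := by
  have hk (k : ℕ) : h i ((f i ^ k) v) = (c - 2 * k) • (f i ^ k) v := by
    induction k with
    | zero => simp [hh]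
    | succ k ih =>
      rw [pow_succ', Module.End.mul_apply, R.h_f, ih, hA, map_smul, ← sub_smul]
      congr 1; push_cast; ring
  induction k with
  | zero => simp [R.e_f, he, hh]
  | succ k ih =>
    rw [pow_succ', Module.End.mul_apply, R.e_f, ih, if_pos rfl, hk, map_smul,
      ← Module.End.mul_apply, ← pow_succ', ← add_smul]
    congr 1; push_cast; ring

omit [Fintype I] in
lemma ChevalleyRep.e_pow_f_pow (R : ChevalleyRep A e f h) (hA : ∀ i, A i i = 2) {i : I} {c : ℂ}
    (he : e i v = 0) (hh : h i v = c • v) (k : ℕ) :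
    (e i ^ k) ((f i ^ k) v) = (∏ l ∈ Finset.range k, ((l + 1) * (c - l) : ℂ)) • v := by
  induction k with
  | zero => simp
  | succ k ih =>
    rw [pow_succ (e i), Module.End.mul_apply, R.e_f_pow_succ hA he hh, map_smul, ih, smul_smul,
      Finset.prod_range_succ, mul_comm]

omit [Fintype I] in
lemma ChevalleyRep.f_pow_ne_zero (R : ChevalleyRep A e f h) (hA : ∀ i, A i i = 2) {i : I} {p k : ℕ}
    (he : e i v = 0) (hh : h i v = (p : ℂ) • v) (hk : k ≤ p) (h0 : v ≠ 0) : (f i ^ k) v ≠ 0 := by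
  intro h1
  have h2 := R.e_pow_f_pow hA he hh k
  rw [h1, map_zero, eq_comm, smul_eq_zero, or_iff_left h0, Finset.prod_eq_zero_iff] at h2
  obtain ⟨l, hl, h3⟩ := h2
  have hl' := Finset.mem_range.1 hl
  rcases mul_eq_zero.1 h3 with h4 | h4
  · exact Nat.cast_add_one_ne_zero l h4
  · rw [sub_eq_zero, Nat.cast_inj] at h4
    omega

omit [Fintype I] in
lemma ChevalleyRep.e_pow_f_pow_self (R : ChevalleyRep A e f h) (hA : ∀ i, A i i = 2) {i : I}
    {p : ℕ} (he : e i v = 0) (hh : h i v = (p : ℂ) • v) :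
    (e i ^ p) ((f i ^ p) v) = ((p.factorial : ℂ) * p.factorial) • v := by
  rw [R.e_pow_f_pow hA he hh, Finset.prod_mul_distrib]
  congr 2
  · exact_mod_cast Finset.prod_range_add_one_eq_factorial p
  · rw [← Finset.prod_range_reflect, ← Finset.prod_range_add_one_eq_factorial]
    push_cast
    refine Finset.prod_congr rfl fun l hl => ?_
    have hl' := Finset.mem_range.1 hl
    rw [Nat.sub_sub, Nat.cast_sub (by omega)]
    push_cast; ring

end Operators

/-! ### Irreducible highest weight representations with dominant integral highest weight -/

section HighestWeight

variable {I V : Type*} [Fintype I] [DecidableEq I] [AddCommGroup V] [Module ℂ V]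

/-- An irreducible representation with highest weight vector `u` of dominant integral weight `lam`
of the Kac-Moody algebra of a nondegenerate matrix `A` which is symmetrized by `d`. -/
structure HighestWeightRep (A : Matrix I I ℤ) (e f h : I → Module.End ℂ V) (d : I → ℤ)
    (lam : I → ℕ) (u : V) : Prop extends ChevalleyRep A e f h where
  irreducible : ∀ P : Submodule ℂ V, (∀ i x, x ∈ P → e i x ∈ P) → (∀ i x, x ∈ P → f i x ∈ P) →
    (∀ i x, x ∈ P → h i x ∈ P) → P ≠ ⊥ → P = ⊤
  u_ne_zero : u ≠ 0
  h_u : IsWt h (fun i => (lam i : ℂ)) u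
  e_u : ∀ i, e i u = 0
  serre : ∀ i j, ∃ K : ℕ, (fun g : Module.End ℂ V => f i * g - g * f i)^[K] (f j) = 0
  nondegenerate : ∀ m : I → ℤ, (∀ i, ∑ j, A i j * m j = 0) → m = 0
  diag : ∀ i, A i i = 2
  d_pos : ∀ i, 0 < d i
  d_symm : ∀ i j, d i * A i j = d j * A j i

/-- The value at `h_i` of the weight `lam - ∑ j, m_j α_j`. -/
def wtVal (A : Matrix I I ℤ) (lam : I → ℕ) (m : I → ℤ) (i : I) : ℤ := lam i - ∑ k, A i k * m k

/-- The difference of the squared norms of the weights `lam` and `lam - ∑ j, m_j α_j`. -/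
def normDrop (A : Matrix I I ℤ) (d : I → ℤ) (lam : I → ℕ) (m : I → ℤ) : ℤ :=
  ∑ j, d j * m j * (lam j + wtVal A lam m j)

/-- `v` is a nonzero vector of weight `lam - ∑ j, m_j α_j`, and this weight has the same norm as
`lam`. -/
structure IsExtremal (A : Matrix I I ℤ) (h : I → Module.End ℂ V) (d : I → ℤ) (lam : I → ℕ)
    (m : I → ℤ) (v : V) : Prop where
  ne_zero : v ≠ 0
  weight : IsWt h (shift A (fun i => (lam i : ℂ)) (-m)) v
  norm : normDrop A d lam m = 0

variable {A : Matrix I I ℤ} {e f h : I → Module.End ℂ V} {d : I → ℤ} {lam : I → ℕ}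
  {μ ν : I → ℂ} {u v x y z : V}

omit [DecidableEq I] in
lemma shift_eq_wtVal (m : I → ℤ) (i : I) :
    shift A (fun i => (lam i : ℂ)) (-m) i = (wtVal A lam m i : ℂ) := by
  simp [shift, wtVal, sub_eq_add_neg]

lemma wtVal_add_single (m : I → ℤ) (i : I) (t : ℤ) (j : I) :
    wtVal A lam (m + Pi.single i t) j = wtVal A lam m j - A j i * t := by
  simp only [wtVal, Pi.add_apply, mul_add, Finset.sum_add_distrib]
  rw [Finset.sum_eq_single (f := fun k => A j k * (Pi.single i t : I → ℤ) k) i] <;>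
    simp +contextual
  ring

/-- This expands |μ|² - |μ - tα_i|² in the invariant form with (α_i, α_j) = d_i A_ij. In particular
t = μ(h_i), the simple reflection, does not change the norm. -/
lemma normDrop_add_single (hA : A i i = 2) (hd : ∀ i j, d i * A i j = d j * A j i) (m : I → ℤ)
    (t : ℤ) :
    normDrop A d lam (m + Pi.single i t) =
      normDrop A d lam m + 2 * d i * t * (wtVal A lam m i - t) := by
  have h1 : ∑ j, d j * m j * A j i = d i * (lam i - wtVal A lam m i) := by
    simp only [wtVal, sub_sub_cancel, Finset.mul_sum]
    refine Finset.sum_congr rfl fun j _ => ?_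
    linear_combination -(m j) * hd i j
  have h2 : ∑ j, d j * (Pi.single i t : I → ℤ) j * (lam j + wtVal A lam (m + Pi.single i t) j) =
      d i * t * (lam i + wtVal A lam m i - 2 * t) := by
    rw [Finset.sum_eq_single i]
    · rw [wtVal_add_single, hA, Pi.single_eq_same]; ring
    · intro j _ hj; simp [hj]
    · simp
  have h3 : ∑ j, d j * m j * (lam j + wtVal A lam (m + Pi.single i t) j) =
      normDrop A d lam m - t * ∑ j, d j * m j * A j i := by
    rw [normDrop, Finset.mul_sum, ← Finset.sum_sub_distrib]
    refine Finset.sum_congr rfl fun j _ => ?_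
    rw [wtVal_add_single]; ring
  have h4 : normDrop A d lam (m + Pi.single i t) =
      ∑ j, d j * m j * (lam j + wtVal A lam (m + Pi.single i t) j) +
      ∑ j, d j * (Pi.single i t : I → ℤ) j * (lam j + wtVal A lam (m + Pi.single i t) j) := by
    rw [normDrop, ← Finset.sum_add_distrib]
    refine Finset.sum_congr rfl fun j _ => ?_
    rw [Pi.add_apply]; ring
  rw [h4, h2, h3, h1]; ring

namespace HighestWeightRep

/-- Since the `e i` kill `x`, the span of the f-words is stable under all generators, and
irreducibility applies. Passing to `R.swap` exchanges the roles of `e` and `f`. -/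
lemma irreducible_wordSpan_f (R : HighestWeightRep A e f h d lam u) (hx : IsWt h μ x)
    (he : ∀ i, e i x = 0) (h0 : x ≠ 0) : wordSpan f x = ⊤ := by
  have hx' := isWt_neg.2 hx
  refine R.irreducible _ (fun i z hz => ?_) (fun i z hz => apply_mem_wordSpan hz i)
    (fun i z hz => ?_) ?_
  · exact R.swap.f_mem_wordSpan hx' i (by rw [he]; exact Submodule.zero_mem _) hz
  · simpa using R.swap.h_mem_wordSpan hx' i hz
  · exact fun hb => h0 ((Submodule.eq_bot_iff _).1 hb x self_mem_wordSpan)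

lemma irreducible_wordSpan_e (R : HighestWeightRep A e f h d lam u) (hx : IsWt h μ x)
    (hf : ∀ i, f i x = 0) (h0 : x ≠ 0) : wordSpan e x = ⊤ := by
  refine R.irreducible _ (fun i z hz => apply_mem_wordSpan hz i) (fun i z hz => ?_)
    (fun i z hz => R.h_mem_wordSpan hx i hz) ?_
  · exact R.f_mem_wordSpan hx i (by rw [hf]; exact Submodule.zero_mem _) hz
  · exact fun hb => h0 ((Submodule.eq_bot_iff _).1 hb x self_mem_wordSpan)

end HighestWeightRep

lemma ChevalleyRep.wordSpan_f_le_sup (R : ChevalleyRep A e f h) (hv : IsWt h μ v) :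
    wordSpan f v ≤ Submodule.span ℂ {v} ⊔ Submodule.span ℂ
      {z | ∃ ν, (∃ m : I → ℕ, m ≠ 0 ∧ ν = shift A μ (-fun i => (m i : ℤ))) ∧ IsWt h ν z} := by
  refine (R.swap.wordSpan_le_sup (isWt_neg.2 hv)).trans (sup_le_sup_left (Submodule.span_mono ?_) _)
  rintro z ⟨ν, ⟨m, hm, rfl⟩, hz⟩
  rw [shift_neg, isWt_neg] at hz
  exact ⟨_, ⟨m, hm, rfl⟩, hz⟩

lemma ChevalleyRep.wordSpan_f_le_span (R : ChevalleyRep A e f h) (hv : IsWt h μ v) :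
    wordSpan f v ≤ Submodule.span ℂ
      {z | ∃ ν, (∃ m : I → ℕ, ν = shift A μ (-fun i => (m i : ℤ))) ∧ IsWt h ν z} := by
  refine (R.swap.wordSpan_le_span (isWt_neg.2 hv)).trans (Submodule.span_mono ?_)
  rintro z ⟨ν, ⟨m, rfl⟩, hz⟩
  rw [shift_neg, isWt_neg] at hz
  exact ⟨_, ⟨m, rfl⟩, hz⟩

/-- If `(ad g)^K a = 0`, then `a` preserves the space of vectors on which `g` is nilpotent. -/
lemma exists_pow_apply_eq_zero (g : Module.End ℂ V) (K : ℕ) (a : Module.End ℂ V)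
    (ha : (fun b : Module.End ℂ V => g * b - b * g)^[K] a = 0) (N : ℕ) (x : V)
    (hx : (g ^ N) x = 0) : ∃ N', (g ^ N') (a x) = 0 := by
  induction K generalizing a N x with
  | zero =>
    have ha' : a = 0 := ha
    exact ⟨0, by simp [ha']⟩
  | succ K ihK =>
    induction N generalizing x with
    | zero =>
      have hx' : x = 0 := by simpa using hx
      exact ⟨0, by simp [hx']⟩
    | succ N ihN =>
      rw [Function.iterate_succ_apply] at ha
      -- Write g a x = a g x + [g, a] x. The induction on `N` handles the first term, and the
      -- induction on `K` the second, since one commutator with g has been used up.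
      obtain ⟨N₁, h₁⟩ := ihN (g x) (by rwa [← Module.End.mul_apply, ← pow_succ])
      obtain ⟨N₂, h₂⟩ := ihK _ ha (N + 1) x hx
      refine ⟨N₁ + N₂ + 1, ?_⟩
      have h3 : g (a x) = a (g x) + (g * a - a * g) x := by simp
      rw [pow_succ, Module.End.mul_apply, h3, map_add, pow_add, Module.End.mul_apply,
        Module.End.mul_apply, h₂, map_zero, add_zero, ← Module.End.mul_apply, ← pow_add, add_comm,
        pow_add, Module.End.mul_apply, h₁, map_zero]

namespace HighestWeightRep

lemma wordSpan_f_u (R : HighestWeightRep A e f h d lam u) : wordSpan f u = ⊤ :=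
  R.irreducible_wordSpan_f R.h_u R.e_u R.u_ne_zero

lemma mem_sup (R : HighestWeightRep A e f h d lam u) (x : V) :
    x ∈ Submodule.span ℂ {u} ⊔ Submodule.span ℂ
      {z | ∃ ν, (∃ m : I → ℕ, m ≠ 0 ∧ ν = shift A (fun i => (lam i : ℂ)) (-fun i => (m i : ℤ))) ∧
        IsWt h ν z} :=
  R.wordSpan_f_le_sup R.h_u (R.wordSpan_f_u ▸ Submodule.mem_top)

lemma exists_weight_eq (R : HighestWeightRep A e f h d lam u) (hx : IsWt h μ x) (h0 : x ≠ 0) :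
    ∃ m : I → ℕ, μ = shift A (fun i => (lam i : ℂ)) (-fun i => (m i : ℤ)) :=
  R.weight_mem hx h0 (R.wordSpan_f_le_span R.h_u (R.wordSpan_f_u ▸ Submodule.mem_top))

lemma u_notMem (R : HighestWeightRep A e f h d lam u) :
    u ∉ Submodule.span ℂ
      {z | ∃ ν, (∃ m : I → ℕ, m ≠ 0 ∧ ν = shift A (fun i => (lam i : ℂ)) (-fun i => (m i : ℤ))) ∧
        IsWt h ν z} := by
  intro hu
  obtain ⟨m, hm, h1⟩ := R.weight_mem R.h_u R.u_ne_zero hu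
  rw [← shift_zero (A := A) (μ := fun i => (lam i : ℂ)), shift_shift] at h1
  have h2 := shift_injective R.nondegenerate h1
  apply hm
  ext i
  simpa using congrFun h2 i

/-- If nonzero, this vector would be singular: `e_f_pow_succ` has the factor λ(h_i) - λ(h_i) = 0. It
would then generate the module, yet all weights below it miss that of `u`. -/
lemma f_pow_u (R : HighestWeightRep A e f h d lam u) (i : I) : (f i ^ (lam i + 1)) u = 0 := by
  by_contra h0
  have hw := R.h_u.lower_pow R.toChevalleyRep i (lam i + 1)
  have he (j : I) : e j ((f i ^ (lam i + 1)) u) = 0 := by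
    by_cases hij : j = i
    · subst hij
      rw [R.e_f_pow_succ R.diag (R.e_u j) (R.h_u j)]
      simp
    · have (k : ℕ) : e j ((f i ^ k) u) = 0 := by
        induction k with
        | zero => simp [R.e_u]
        | succ k ih => rw [pow_succ', Module.End.mul_apply, R.e_f, ih, if_neg hij]; simp
      exact this _
  have h1 := R.irreducible_wordSpan_f hw he h0
  have h2 : u ∈ wordSpan f ((f i ^ (lam i + 1)) u) := h1 ▸ Submodule.mem_top
  obtain ⟨m, hm⟩ := R.weight_mem R.h_u R.u_ne_zero (R.wordSpan_f_le_span hw h2)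
  rw [← shift_zero (A := A) (μ := fun i => (lam i : ℂ)), shift_shift, shift_shift] at hm
  have h3 := congrFun (shift_injective R.nondegenerate hm) i
  simp at h3
  omega

/-- The vectors on which `f i` is nilpotent form a subspace containing `u`. By the Serre relations
it is stable under every `f j`, hence it is everything. -/
lemma exists_f_pow_eq_zero (R : HighestWeightRep A e f h d lam u) (i : I) (x : V) :
    ∃ N, (f i ^ N) x = 0 := by
  let P : Submodule ℂ V :=
    { carrier := {x | ∃ N, (f i ^ N) x = 0}
      zero_mem' := ⟨0, by simp⟩
      add_mem' := by
        rintro x y ⟨N, hN⟩ ⟨N', hN'⟩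
        refine ⟨N + N', ?_⟩
        rw [map_add, pow_add, Module.End.mul_apply, Module.End.mul_apply, hN', map_zero, add_zero,
          ← Module.End.mul_apply, ← pow_add, add_comm, pow_add, Module.End.mul_apply, hN, map_zero]
      smul_mem' := by
        rintro c x ⟨N, hN⟩
        exact ⟨N, by rw [map_smul, hN, smul_zero]⟩ }
  have h1 : wordSpan f u ≤ P := by
    refine wordSpan_le ⟨_, R.f_pow_u i⟩ ?_
    rintro j x ⟨N, hN⟩
    obtain ⟨K, hK⟩ := R.serre i j
    exact exists_pow_apply_eq_zero (f i) K (f j) hK N x hN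
  exact h1 (R.wordSpan_f_u ▸ Submodule.mem_top)

/-- If a weight `μ` satisfies `μ(h_i) = -p`, then its reflection `μ + p α_i` is a weight, too. -/
lemma exists_reflected (R : HighestWeightRep A e f h d lam u) (hx : IsWt h μ x) (h0 : x ≠ 0)
    {i : I} {p : ℕ} (hp : μ i = -(p : ℂ)) :
    ∃ x' : V, x' ≠ 0 ∧ IsWt h (shift A μ (Pi.single i (p : ℤ))) x' := by
  classical
  have hN := R.exists_f_pow_eq_zero i x
  obtain ⟨r, hr⟩ : ∃ r, Nat.find hN = r + 1 :=
    Nat.exists_eq_succ_of_ne_zero fun hz => h0 (by simpa [hz] using Nat.find_spec hN)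
  have hy0 : (f i ^ r) x ≠ 0 := Nat.find_min hN (by omega)
  have hfy : f i ((f i ^ r) x) = 0 := by
    rw [← Module.End.mul_apply, ← pow_succ', ← hr]; exact Nat.find_spec hN
  have hy := hx.lower_pow R.toChevalleyRep i r
  -- At the bottom of the f-string -h_i has eigenvalue p + 2r, so the string survives p + r ≤ p + 2r
  -- steps upwards; the first r of them undo the descent in weight.
  refine ⟨(e i ^ (p + r)) ((f i ^ r) x), ?_, ?_⟩
  · refine R.swap.f_pow_ne_zero (p := p + 2 * r) R.diag hfy ?_ (by omega) hy0
    rw [LinearMap.neg_apply, hy i, shift_single, hp, R.diag, ← neg_smul]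
    congr 1; push_cast; ring
  · have := hy.raise_pow R.toChevalleyRep i (p + r)
    have hk : -(r : ℤ) + ((p + r : ℕ) : ℤ) = p := by push_cast; ring
    rwa [shift_shift, ← Pi.single_add, hk] at this

/-- For a dominant weight μ, |λ|² - |μ|² = (λ - μ, λ + μ) pairs a nonnegative combination of simple
roots with a dominant weight. If μ(h_i) < 0, the reflected weight has the same norm and is closer to
λ, so induction on the height of λ - μ finishes. -/
lemma normDrop_nonneg (R : HighestWeightRep A e f h d lam u) (m : I → ℕ) (h0 : x ≠ 0)
    (hx : IsWt h (shift A (fun i => (lam i : ℂ)) (-fun i => (m i : ℤ))) x) :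
    0 ≤ normDrop A d lam (fun i => m i) := by
  obtain ⟨N, hN⟩ : ∃ N, ∑ i, m i = N := ⟨_, rfl⟩
  induction N using Nat.strong_induction_on generalizing m x with
  | _ N ih =>
  by_cases hdom : ∀ i, 0 ≤ wtVal A lam (fun i => m i) i
  · refine Finset.sum_nonneg fun j _ => mul_nonneg (mul_nonneg (R.d_pos j).le (by positivity)) ?_
    have := hdom j
    positivity
  · push Not at hdom
    obtain ⟨i, hi⟩ := hdom
    obtain ⟨p, hp⟩ := Int.eq_ofNat_of_zero_le (neg_nonneg.2 hi.le)
    have hp' : wtVal A lam (fun i => m i) i = -(p : ℤ) := by omega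
    obtain ⟨x', hx0', hx'⟩ := R.exists_reflected hx h0 (i := i) (p := p)
      (by rw [shift_eq_wtVal, hp']; simp)
    obtain ⟨m', hm'⟩ := R.exists_weight_eq hx' hx0'
    rw [hm'] at hx'
    rw [shift_shift] at hm'
    have h1 := shift_injective R.nondegenerate hm'
    have h2 : (fun i => (m' i : ℤ)) = (fun i => (m i : ℤ)) + Pi.single i (-(p : ℤ)) := by
      rw [Pi.single_neg, ← neg_inj, ← h1]; abel
    have h3 : (∑ j, m' j : ℕ) + (p : ℤ) = (∑ j, m j : ℕ) := by
      push_cast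
      rw [show ∑ j, (m' j : ℤ) = ∑ j, ((m j : ℤ) + (Pi.single i (-(p : ℤ)) : I → ℤ) j) from
        Finset.sum_congr rfl fun j _ => congrFun h2 j]
      rw [Finset.sum_add_distrib, Finset.sum_pi_single']
      simp
    have h4 := ih (∑ j, m' j) (by omega) m' hx0' hx' rfl
    rw [h2, normDrop_add_single (R.diag i) R.d_symm, hp'] at h4
    simpa using h4

/-- Otherwise the weight μ + α_i would occur, and it is strictly longer than λ when μ(h_i) ≥ 0. -/
lemma _root_.ClassicalCrystal.IsExtremal.e_eq_zero {m : I → ℤ} (hv : IsExtremal A h d lam m v)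
    (R : HighestWeightRep A e f h d lam u) {i : I} (hi : 0 ≤ wtVal A lam m i) : e i v = 0 := by
  by_contra h0
  have h1 := hv.weight.raise R.toChevalleyRep i
  obtain ⟨m', hm'⟩ := R.exists_weight_eq h1 h0
  have h2 := R.normDrop_nonneg m' h0 (hm' ▸ h1)
  rw [shift_shift] at hm'
  have h3 : (fun i => (m' i : ℤ)) = m + Pi.single i (-1) := by
    rw [Pi.single_neg, ← neg_inj, ← shift_injective R.nondegenerate hm']; abel
  rw [h3, normDrop_add_single (R.diag i) R.d_symm, hv.norm] at h2
  have := R.d_pos i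
  nlinarith

lemma _root_.ClassicalCrystal.IsExtremal.f_eq_zero {m : I → ℤ} (hv : IsExtremal A h d lam m v)
    (R : HighestWeightRep A e f h d lam u) {i : I} (hi : wtVal A lam m i ≤ 0) : f i v = 0 := by
  by_contra h0
  have h1 := hv.weight.lower R.toChevalleyRep i
  obtain ⟨m', hm'⟩ := R.exists_weight_eq h1 h0
  have h2 := R.normDrop_nonneg m' h0 (hm' ▸ h1)
  rw [shift_shift] at hm'
  have h3 : (fun i => (m' i : ℤ)) = m + Pi.single i 1 := by
    rw [← neg_inj, ← shift_injective R.nondegenerate hm', Pi.single_neg]; abel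
  rw [h3, normDrop_add_single (R.diag i) R.d_symm, hv.norm] at h2
  have := R.d_pos i
  nlinarith

omit [DecidableEq I] in
lemma _root_.ClassicalCrystal.IsExtremal.h_apply {m : I → ℤ} (hv : IsExtremal A h d lam m v)
    (i : I) : h i v = (wtVal A lam m i : ℂ) • v := by
  rw [hv.weight i, shift_eq_wtVal]

lemma isExtremal_u (R : HighestWeightRep A e f h d lam u) : IsExtremal A h d lam 0 u where
  ne_zero := R.u_ne_zero
  weight := by rw [neg_zero, shift_zero]; exact R.h_u
  norm := by simp [normDrop]

lemma _root_.ClassicalCrystal.IsExtremal.reflect {m : I → ℤ} (hv : IsExtremal A h d lam m v)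
    (R : HighestWeightRep A e f h d lam u) {i : I} {p : ℕ} (hp : wtVal A lam m i = p) :
    IsExtremal A h d lam (m + Pi.single i (p : ℤ)) ((p.factorial : ℂ)⁻¹ • (f i ^ p) v) where
  ne_zero := by
    refine smul_ne_zero (inv_ne_zero (Nat.cast_ne_zero.2 p.factorial_ne_zero)) ?_
    exact R.f_pow_ne_zero R.diag (hv.e_eq_zero R (by omega)) (by rw [hv.h_apply, hp]; simp) le_rfl
      hv.ne_zero
  weight := by
    have h1 := (hv.weight.lower_pow R.toChevalleyRep i p).smul (p.factorial : ℂ)⁻¹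
    rwa [shift_shift, Pi.single_neg, ← neg_add] at h1
  norm := by rw [normDrop_add_single (R.diag i) R.d_symm, hv.norm, hp]; simp

end HighestWeightRep

end HighestWeight

/-! ### Extremal vectors along a path of weights and the monomial formula -/

section Paths

variable {I V : Type*} [Fintype I] [DecidableEq I] [AddCommGroup V] [Module ℂ V]

/-- `WeightPath A lam w μ`: the word `w` of pairs (label `i`, exponent `p`), read from the right,
leads from `lam` to `μ` by simple reflections `ν ↦ ν - p α_i` with `p = ν(h_i)`. -/
inductive WeightPath (A : Matrix I I ℤ) (lam : I → ℤ) : List (I × ℕ) → (I → ℤ) → Prop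
  | nil : WeightPath A lam [] lam
  | cons {w : List (I × ℕ)} {ν ν' : I → ℤ} {i : I} {p : ℕ} : WeightPath A lam w ν → ν i = p →
      (∀ j, ν' j = ν j - A j i * p) → WeightPath A lam ((i, p) :: w) ν'

/-- The vector obtained from `u` by applying the divided powers `f_i^p / p!` for the pairs `(i, p)`
of a word, from right to left. -/
def dividedWord (f : I → Module.End ℂ V) (w : List (I × ℕ)) (u : V) : V :=
  w.foldr (fun q v => (q.2.factorial : ℂ)⁻¹ • (f q.1 ^ q.2) v) u

/-- `exp(t g) x` for a locally nilpotent operator `g`. -/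
def expOp (g : Module.End ℂ V) (t : ℂ) (x : V) : V :=
  ∑ᶠ k : ℕ, (t ^ k / (k.factorial : ℂ)) • (g ^ k) x

/-- A contravariant bilinear form, normalized at `u`. -/
structure IsContravariant (e f h : I → Module.End ℂ V) (u : V) (B : LinearMap.BilinForm ℂ V) :
    Prop where
  f_left : ∀ i x y, B (f i x) y = B x (e i y)
  h_left : ∀ i x y, B (h i x) y = B x (h i y)
  apply_u : B u u = 1

variable {A : Matrix I I ℤ} {e f h : I → Module.End ℂ V} {d : I → ℤ} {lam : I → ℕ}
  {μ ν : I → ℂ} {u v x y z : V} {B : LinearMap.BilinForm ℂ V}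

omit [Fintype I] [DecidableEq I] in
lemma IsContravariant.f_pow_left (hB : IsContravariant e f h u B) (i : I) (k : ℕ) (x y : V) :
    B ((f i ^ k) x) y = B x ((e i ^ k) y) := by
  induction k generalizing y with
  | zero => simp
  | succ k ih =>
    rw [pow_succ' (f i), pow_succ (e i), Module.End.mul_apply, Module.End.mul_apply, hB.f_left, ih]

omit [Fintype I] [DecidableEq I] in
lemma IsContravariant.apply_eq_zero (hB : IsContravariant e f h u B) (hx : IsWt h μ x)
    (hy : IsWt h ν y) (hne : μ ≠ ν) : B x y = 0 := by
  obtain ⟨i, hi⟩ := Function.ne_iff.1 hne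
  have h1 := hB.h_left i x y
  rw [hx i, hy i, map_smul, map_smul, LinearMap.smul_apply, smul_eq_mul, smul_eq_mul] at h1
  by_contra h0
  exact hi (mul_right_cancel₀ h0 h1)

lemma HighestWeightRep.isExtremal_dividedWord (R : HighestWeightRep A e f h d lam u)
    {w : List (I × ℕ)} {μ : I → ℤ} (hw : WeightPath A (fun i => (lam i : ℤ)) w μ) :
    ∃ m, wtVal A lam m = μ ∧ IsExtremal A h d lam m (dividedWord f w u) := by
  induction hw with
  | nil => exact ⟨0, by ext i; simp [wtVal], R.isExtremal_u⟩
  | @cons w ν ν' i p _ hp hν ih =>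
    obtain ⟨m, hm, hv⟩ := ih
    refine ⟨_, ?_, hv.reflect R (i := i) (p := p) (by rw [hm, hp])⟩
    ext j
    rw [wtVal_add_single, hm, hν]

/-- Local nilpotence makes the support finite, so `finsum` does not take its default value 0. Every
larger cutoff is allowed, so that a sum can be extended to contain a prescribed index. -/
lemma HighestWeightRep.exists_exp_eq_sum (R : HighestWeightRep A e f h d lam u) (i : I) (t : ℂ)
    (x : V) : ∃ N, ∀ N', N ≤ N' → expOp (f i) t x =
      ∑ k ∈ Finset.range N', (t ^ k / (k.factorial : ℂ)) • (f i ^ k) x := by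
  obtain ⟨N, hN⟩ := R.exists_f_pow_eq_zero i x
  refine ⟨N, fun N' hN' => finsum_eq_sum_of_support_subset _ fun k hk => ?_⟩
  by_contra hk'
  apply hk
  have hk'' : N ≤ k := hN'.trans (by simpa using hk')
  have : (f i ^ k) x = 0 := by
    rw [← Nat.sub_add_cancel hk'', pow_add, Module.End.mul_apply, hN, map_zero]
  simp only [this, smul_zero]

lemma HighestWeightRep.exp_mem (R : HighestWeightRep A e f h d lam u) (i : I) (t : ℂ)
    {P : Submodule ℂ V} (hP : ∀ x ∈ P, f i x ∈ P) (hx : x ∈ P) : expOp (f i) t x ∈ P := by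
  obtain ⟨N, hN⟩ := R.exists_exp_eq_sum i t x
  rw [hN N le_rfl]
  exact P.sum_mem fun k _ => P.smul_mem _ (pow_apply_mem hP hx k)

/-! ### One simple reflection: the effect of a single exponential factor -/

section Step

variable {m : I → ℤ} {i : I} {p : ℕ}

lemma IsExtremal.e_pow_reflect (hv : IsExtremal A h d lam m v)
    (R : HighestWeightRep A e f h d lam u) (hp : wtVal A lam m i = p) :
    (e i ^ p) ((p.factorial : ℂ)⁻¹ • (f i ^ p) v) = (p.factorial : ℂ) • v := by
  have hp0 : (p.factorial : ℂ) ≠ 0 := Nat.cast_ne_zero.2 p.factorial_ne_zero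
  rw [map_smul, R.e_pow_f_pow_self R.diag (hv.e_eq_zero R (by omega))
    (by rw [hv.h_apply, hp]; simp), smul_smul, inv_mul_cancel_left₀ hp0]

lemma IsExtremal.wordSpan_le_reflect (hv : IsExtremal A h d lam m v)
    (R : HighestWeightRep A e f h d lam u) (hp : wtVal A lam m i = p) :
    wordSpan e v ≤ wordSpan e ((p.factorial : ℂ)⁻¹ • (f i ^ p) v) := by
  refine wordSpan_le ?_ fun j x hx => apply_mem_wordSpan hx j
  have h1 := pow_apply_mem (g := e i) (fun x hx => apply_mem_wordSpan hx i)
    (self_mem_wordSpan (e := e) (v := (p.factorial : ℂ)⁻¹ • (f i ^ p) v)) p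
  rw [hv.e_pow_reflect R hp] at h1
  exact (Submodule.smul_mem_iff _ (Nat.cast_ne_zero.2 p.factorial_ne_zero)).1 h1

lemma IsExtremal.f_reflect (hv : IsExtremal A h d lam m v)
    (R : HighestWeightRep A e f h d lam u) (hp : wtVal A lam m i = p) :
    f i ((p.factorial : ℂ)⁻¹ • (f i ^ p) v) = 0 := by
  refine (hv.reflect R hp).f_eq_zero R ?_
  rw [wtVal_add_single, R.diag, hp]
  omega

/-- The span grows from `v` to the reflected vector, because `v` is recovered by e_i^p. The larger
span is stable under `f i`, because `f i` kills the reflected vector. -/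
lemma IsExtremal.exp_mem_reflect (hv : IsExtremal A h d lam m v)
    (R : HighestWeightRep A e f h d lam u) (hp : wtVal A lam m i = p) (t : ℂ)
    (hz : z ∈ wordSpan e v) :
    expOp (f i) t z ∈ wordSpan e ((p.factorial : ℂ)⁻¹ • (f i ^ p) v) :=
  R.exp_mem i t (fun _ hx => R.f_mem_wordSpan (hv.reflect R hp).weight i
    (by rw [hv.f_reflect R hp]; exact Submodule.zero_mem _) hx) (hv.wordSpan_le_reflect R hp hz)

/-- After moving f_i^k to the right argument: for k < p the weight there is wt(v) - (p - k)α_i,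
which does not occur in `wordSpan e v`; for k > p the vector is a multiple of e_i^{k-p} v = 0. -/
lemma IsExtremal.pow_apply_reflect (hv : IsExtremal A h d lam m v)
    (R : HighestWeightRep A e f h d lam u) (hp : wtVal A lam m i = p)
    (hB : IsContravariant e f h u B) (hz : z ∈ wordSpan e v) {k : ℕ} (hk : k ≠ p) :
    B ((f i ^ k) z) ((p.factorial : ℂ)⁻¹ • (f i ^ p) v) = 0 := by
  rw [hB.f_pow_left]
  rcases lt_or_gt_of_ne hk with hlt | hgt
  · have h1 := (hv.reflect R hp).weight.raise_pow R.toChevalleyRep i k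
    rw [shift_shift] at h1
    refine (Submodule.span_le.2 ?_ : _ ≤ LinearMap.ker (B.flip _))
      (R.wordSpan_le_span hv.weight hz)
    rintro x ⟨ν, ⟨m', rfl⟩, hx⟩
    refine hB.apply_eq_zero hx h1 fun hne => ?_
    rw [shift_shift] at hne
    have h2 := congrFun (shift_injective R.nondegenerate hne) i
    simp at h2
    omega
  · obtain ⟨r, rfl⟩ := Nat.exists_eq_add_of_lt hgt
    rw [show p + r + 1 = (r + 1) + p by ring, pow_add, Module.End.mul_apply,
      hv.e_pow_reflect R hp, pow_succ, Module.End.mul_apply, map_smul,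
      hv.e_eq_zero R (by omega), smul_zero, map_zero, map_zero]

/-- Only the term k = p of the exponential contributes, and its 1/p! cancels the p! from e_i^p v' =
p! v. -/
lemma IsExtremal.exp_apply_reflect (hv : IsExtremal A h d lam m v)
    (R : HighestWeightRep A e f h d lam u) (hp : wtVal A lam m i = p)
    (hB : IsContravariant e f h u B) (hz : z ∈ wordSpan e v) (t : ℂ) :
    B (expOp (f i) t z) ((p.factorial : ℂ)⁻¹ • (f i ^ p) v) = t ^ p * B z v := by
  have hp0 : (p.factorial : ℂ) ≠ 0 := Nat.cast_ne_zero.2 p.factorial_ne_zero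
  have hself : B ((f i ^ p) z) ((p.factorial : ℂ)⁻¹ • (f i ^ p) v) = p.factorial * B z v := by
    rw [hB.f_pow_left, hv.e_pow_reflect R hp, map_smul, smul_eq_mul]
  obtain ⟨N, hN⟩ := R.exists_exp_eq_sum i t z
  rw [hN (N + p + 1) (by omega), map_sum, LinearMap.sum_apply, Finset.sum_eq_single p]
  · rw [map_smul B, LinearMap.smul_apply, hself, smul_eq_mul]
    field_simp
  · intro k _ hk
    rw [map_smul B, LinearMap.smul_apply, hv.pow_apply_reflect R hp hB hz hk, smul_zero]
  · intro hn
    exact absurd (Finset.mem_range.2 (by omega)) hn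

lemma IsExtremal.apply_self_reflect (hv : IsExtremal A h d lam m v)
    (R : HighestWeightRep A e f h d lam u) (hp : wtVal A lam m i = p)
    (hB : IsContravariant e f h u B) :
    B ((p.factorial : ℂ)⁻¹ • (f i ^ p) v) ((p.factorial : ℂ)⁻¹ • (f i ^ p) v) = B v v := by
  have hp0 : (p.factorial : ℂ) ≠ 0 := Nat.cast_ne_zero.2 p.factorial_ne_zero
  rw [map_smul B, LinearMap.smul_apply, hB.f_pow_left, hv.e_pow_reflect R hp, map_smul,
    smul_eq_mul, smul_eq_mul, inv_mul_cancel_left₀ hp0]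

end Step

lemma HighestWeightRep.apply_self_dividedWord (R : HighestWeightRep A e f h d lam u)
    (hB : IsContravariant e f h u B) {w : List (I × ℕ)} {μ : I → ℤ}
    (hw : WeightPath A (fun i => (lam i : ℤ)) w μ) :
    B (dividedWord f w u) (dividedWord f w u) = 1 := by
  induction hw with
  | nil => exact hB.apply_u
  | @cons w ν ν' i p hw hp _ ih =>
    obtain ⟨m, hm, hv⟩ := R.isExtremal_dividedWord hw
    exact (hv.apply_self_reflect R (by rw [hm, hp]) hB).trans ih

/-- The membership has to be carried along with the formula, since the one-step identity holds only
for vectors in the span of e-words on the current extremal vector. -/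
lemma HighestWeightRep.exp_word_apply (R : HighestWeightRep A e f h d lam u)
    (hB : IsContravariant e f h u B) {T : Type*} (l : List T) (lab : T → I) (p : T → ℕ)
    (c : T → ℂ) {μ : I → ℤ}
    (hw : WeightPath A (fun i => (lam i : ℤ)) (l.map fun t => (lab t, p t)) μ) :
    l.foldr (fun t z => expOp (f (lab t)) (c t) z) u ∈
      wordSpan e (dividedWord f (l.map fun t => (lab t, p t)) u) ∧
    B (l.foldr (fun t z => expOp (f (lab t)) (c t) z) u)
      (dividedWord f (l.map fun t => (lab t, p t)) u) = (l.map fun t => c t ^ p t).prod := by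
  induction l generalizing μ with
  | nil => exact ⟨self_mem_wordSpan, by simpa [dividedWord] using hB.apply_u⟩
  | cons t l ih =>
    rw [List.map_cons] at hw
    cases hw with
    | @cons _ ν _ _ _ hw hp _ =>
      obtain ⟨m, hm, hv⟩ := R.isExtremal_dividedWord hw
      obtain ⟨h1, h2⟩ := ih hw
      have hp' : wtVal A lam m (lab t) = p t := by rw [hm, hp]
      refine ⟨hv.exp_mem_reflect R hp' (c t) h1, ?_⟩
      rw [List.map_cons, List.map_cons, List.prod_cons, ← h2]
      exact hv.exp_apply_reflect R hp' hB h1 (c t)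

/-- If the path ends in an antidominant weight, the extremal vector is a lowest weight vector. -/
lemma HighestWeightRep.f_dividedWord (R : HighestWeightRep A e f h d lam u) {w : List (I × ℕ)}
    {μ : I → ℤ} (hw : WeightPath A (fun i => (lam i : ℤ)) w μ) (hμ : ∀ i, μ i ≤ 0) (i : I) :
    f i (dividedWord f w u) = 0 := by
  obtain ⟨m, hm, hv⟩ := R.isExtremal_dividedWord hw
  exact hv.f_eq_zero R (by rw [hm]; exact hμ i)

/-- Each of the two vectors generates the module by e-words, so each weight is ≥ the other and they
agree. The component of strictly higher weight then vanishes, and only the multiple of `x` remains.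
-/
lemma HighestWeightRep.exists_smul_of_lowest (R : HighestWeightRep A e f h d lam u)
    (hx : IsWt h μ x) (hfx : ∀ i, f i x = 0) (h0 : x ≠ 0)
    (hy : IsWt h ν y) (hfy : ∀ i, f i y = 0) (hy0 : y ≠ 0) : ∃ c : ℂ, y = c • x := by
  have hyx : y ∈ wordSpan e x := R.irreducible_wordSpan_e hx hfx h0 ▸ Submodule.mem_top
  have hxy : x ∈ wordSpan e y := R.irreducible_wordSpan_e hy hfy hy0 ▸ Submodule.mem_top
  obtain ⟨m, hm⟩ := R.weight_mem hy hy0 (R.wordSpan_le_span hx hyx)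
  obtain ⟨m', hm'⟩ := R.weight_mem hx h0 (R.wordSpan_le_span hy hxy)
  have h1 : shift A μ 0 = shift A μ ((fun i => (m i : ℤ)) + fun i => (m' i : ℤ)) := by
    rw [← shift_shift, ← hm, ← hm', shift_zero]
  have h2 := shift_injective R.nondegenerate h1
  have h3 : m = 0 := by
    ext i
    have := congrFun h2 i
    simp only [Pi.zero_apply, Pi.add_apply] at this ⊢
    omega
  have h4 : ν = μ := by rw [hm, h3]; exact shift_zero
  obtain ⟨_, ha, b, hb, hab⟩ := Submodule.mem_sup.1 (R.wordSpan_le_sup hx hyx)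
  obtain ⟨c, rfl⟩ := Submodule.mem_span_singleton.1 ha
  refine ⟨c, ?_⟩
  have hb' : IsWt h μ b := by
    rw [← add_sub_cancel_left (c • x) b, hab]
    exact (h4 ▸ hy).sub (hx.smul c)
  have hb0 : b = 0 := by
    refine R.eq_zero_of_mem_span hb' ?_ hb
    rintro ⟨m, hm0, hm⟩
    apply hm0
    rw [← shift_zero (A := A) (μ := μ), shift_shift] at hm
    ext i
    simpa using (congrFun (shift_injective R.nondegenerate hm) i).symm
  rw [← hab, hb0, add_zero]

end Paths

attribute [local instance 100] LieRing.ofAssociativeRing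

/-! ### Generation by the Chevalley generators -/

section Generation

variable {X : ClassicalType} {n : ℕ}

/-- The projection from the free Lie algebra agrees on generators with a map through `K`, and it is
surjective. -/
lemma lieSubalgebra_eq_top (K : LieSubalgebra ℂ (𝔤 X n)) (he : ∀ i, e X i ∈ K)
    (hf : ∀ i, f X i ∈ K) (hh : ∀ i, h X i ∈ K) : K = ⊤ := by
  let g : FreeLieAlgebra ℂ (CartanMatrix.Generators (Node n)) →ₗ⁅ℂ⁆ K :=
    FreeLieAlgebra.lift ℂ fun
      | .H i => ⟨h X i, hh i⟩
      | .E i => ⟨e X i, he i⟩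
      | .F i => ⟨f X i, hf i⟩
  have hg : K.incl.comp g = proj X n := by
    refine FreeLieAlgebra.hom_ext fun x => ?_
    rw [LieHom.comp_apply, FreeLieAlgebra.lift_of_apply]
    cases x <;> rfl
  refine eq_top_iff.2 fun x _ => ?_
  obtain ⟨z, rfl⟩ := LieSubmodule.Quotient.surjective_mk' _ x
  have : proj X n z ∈ K := by rw [← hg]; exact (g z).2
  exact this

/-- The inclusion of 𝔤 factors through `S`; by the universal property the identity of the enveloping
algebra does too. -/
lemma subalgebra_eq_top (S : Subalgebra ℂ (U X n))
    (he : ∀ i, UniversalEnvelopingAlgebra.ι ℂ (e X i) ∈ S)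
    (hf : ∀ i, UniversalEnvelopingAlgebra.ι ℂ (f X i) ∈ S)
    (hh : ∀ i, UniversalEnvelopingAlgebra.ι ℂ (h X i) ∈ S) : S = ⊤ := by
  let K : LieSubalgebra ℂ (𝔤 X n) :=
    { S.toSubmodule.comap (UniversalEnvelopingAlgebra.ι ℂ : 𝔤 X n →ₗ⁅ℂ⁆ U X n).toLinearMap with
      lie_mem' := by
        intro x y hx hy
        change UniversalEnvelopingAlgebra.ι ℂ ⁅x, y⁆ ∈ S
        rw [LieHom.map_lie, LieRing.of_associative_ring_bracket]
        exact S.sub_mem (S.mul_mem hx hy) (S.mul_mem hy hx) }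
  have hK : ∀ x : 𝔤 X n, UniversalEnvelopingAlgebra.ι ℂ x ∈ S := fun x => by
    have : x ∈ K := by rw [lieSubalgebra_eq_top K he hf hh]; trivial
    exact this
  let g : 𝔤 X n →ₗ⁅ℂ⁆ S :=
    { toFun x := ⟨UniversalEnvelopingAlgebra.ι ℂ x, hK x⟩
      map_add' x y := Subtype.ext (map_add _ x y)
      map_smul' c x := Subtype.ext (map_smul _ c x)
      map_lie' := by
        intro x y
        apply Subtype.ext
        rw [LieRing.of_associative_ring_bracket]
        exact (LieHom.map_lie _ x y).trans (LieRing.of_associative_ring_bracket _ _) }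
  have hg : S.val.comp (UniversalEnvelopingAlgebra.lift ℂ g) = AlgHom.id ℂ (U X n) := by
    refine UniversalEnvelopingAlgebra.hom_ext ℂ (LieHom.ext fun x => ?_)
    change S.val (UniversalEnvelopingAlgebra.lift ℂ g (UniversalEnvelopingAlgebra.ι ℂ x)) = _
    rw [UniversalEnvelopingAlgebra.lift_ι_apply]
    rfl
  refine eq_top_iff.2 fun x _ => ?_
  rw [← AlgHom.id_apply (R := ℂ) x, ← hg]
  exact (UniversalEnvelopingAlgebra.lift ℂ g x).2

/-- Stated for any representation, as it also serves for left multiplication on the enveloping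
algebra. -/
lemma chevalleyRep_of_lieHom {W : Type*} [AddCommGroup W] [Module ℂ W]
    (ρ : 𝔤 X n →ₗ⁅ℂ⁆ Module.End ℂ W) :
    ChevalleyRep (cartanMatrix X n) (fun i => ρ (e X i)) (fun i => ρ (f X i))
      (fun i => ρ (h X i)) where
  h_h i j := by
    rw [commute_iff_lie_eq, ← LieHom.map_lie, lie_h_h, map_zero]
  e_f i j x := by
    have h1 : ⁅ρ (e X i), ρ (f X j)⁆ = if i = j then ρ (h X i) else 0 := by
      rw [← LieHom.map_lie]
      split_ifs with hij
      · rw [← hij, lie_e_f_self]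
      · rw [lie_e_f_of_ne hij, map_zero]
    have h2 := LinearMap.congr_fun h1 x
    rw [LieRing.of_associative_ring_bracket, LinearMap.sub_apply, Module.End.mul_apply,
      Module.End.mul_apply, sub_eq_iff_eq_add'] at h2
    rw [h2]
    split_ifs <;> rfl
  h_e i j x := by
    have h1 : ⁅ρ (h X i), ρ (e X j)⁆ = cartanMatrix X n i j • ρ (e X j) := by
      rw [← LieHom.map_lie, lie_h_e, map_zsmul]
    have h2 := LinearMap.congr_fun h1 x
    rw [LieRing.of_associative_ring_bracket, LinearMap.sub_apply, Module.End.mul_apply,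
      Module.End.mul_apply, sub_eq_iff_eq_add'] at h2
    rw [h2, LinearMap.smul_apply, Int.cast_smul_eq_zsmul]
  h_f i j x := by
    have h1 : ⁅ρ (h X i), ρ (f X j)⁆ = -(cartanMatrix X n i j • ρ (f X j)) := by
      rw [← LieHom.map_lie, lie_h_f, map_neg, map_zsmul]
    have h2 := LinearMap.congr_fun h1 x
    rw [LieRing.of_associative_ring_bracket, LinearMap.sub_apply, Module.End.mul_apply,
      Module.End.mul_apply, sub_eq_iff_eq_add'] at h2
    rw [h2, LinearMap.neg_apply, LinearMap.smul_apply, Int.cast_smul_eq_zsmul, sub_eq_add_neg]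

lemma serre_iterate_eq_zero {W : Type*} [AddCommGroup W] [Module ℂ W]
    (ρ : 𝔤 X n →ₗ⁅ℂ⁆ Module.End ℂ W) (i j : Node n) :
    ∃ K : ℕ, (fun g : Module.End ℂ W => ρ (f X i) * g - g * ρ (f X i))^[K] (ρ (f X j)) = 0 := by
  refine ⟨(-cartanMatrix X n i j).toNat + 1, ?_⟩
  have h1 := congrArg ρ (serre_f (X := X) i j)
  rw [map_ad_pow, LieHom.map_lie, map_zero, Module.End.pow_apply] at h1
  rw [Function.iterate_succ_apply]
  exact h1

end Generation

/-! ### The contravariant form of an irreducible highest weight module -/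

section Form

variable {X : ClassicalType} {n : ℕ} {V : Type*} [AddCommGroup V] [Module ℂ V]
  [LieRingModule (𝔤 X n) V] [LieModule ℂ (𝔤 X n) V]

lemma omega_add (a b : U X n) : omega (a + b) = omega a + omega b := by
  rw [omega, map_add, MulOpposite.unop_add, omega, omega]

lemma omega_algebraMap (c : ℂ) : omega (algebraMap ℂ (U X n) c) = algebraMap ℂ (U X n) c := by
  rw [omega, AlgHom.commutes, MulOpposite.algebraMap_apply, MulOpposite.unop_op]

lemma omega_one : omega (1 : U X n) = 1 := by
  rw [omega, map_one, MulOpposite.unop_one]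

lemma omega_smul (c : ℂ) (a : U X n) : omega (c • a) = c • omega a := by
  rw [omega, map_smul, MulOpposite.unop_smul, omega]

lemma omega_omega (a : U X n) : omega (omega a) = a := by
  let S : Subalgebra ℂ (U X n) :=
    { carrier := {a | omega (omega a) = a}
      mul_mem' := fun {a b} ha hb => by
        change omega (omega (a * b)) = a * b
        rw [omega_mul, omega_mul, ha, hb]
      add_mem' := fun {a b} ha hb => by
        change omega (omega (a + b)) = a + b
        rw [omega_add, omega_add, ha, hb]
      algebraMap_mem' := fun c => by
        change omega (omega _) = _
        rw [omega_algebraMap, omega_algebraMap] }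
  have hS : S = ⊤ := by
    refine subalgebra_eq_top S (fun i => ?_) (fun i => ?_) (fun i => ?_)
    · change omega (omega _) = _; rw [omega_e, omega_f]
    · change omega (omega _) = _; rw [omega_f, omega_e]
    · change omega (omega _) = _; rw [omega_h, omega_h]
  have : a ∈ S := by rw [hS]; trivial
  exact this

lemma act_mul (a b : U X n) (x : V) : act (a * b) x = act a (act b x) := by
  rw [act, map_mul]; rfl

lemma act_one (x : V) : act (1 : U X n) x = x := by
  rw [act, map_one]; rfl

lemma act_add (a b : U X n) (x : V) : act (a + b) x = act a x + act b x := by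
  rw [act, map_add]; rfl

lemma act_smul (c : ℂ) (a : U X n) (x : V) : act (c • a) x = c • act a x := by
  rw [act, map_smul]; rfl

lemma act_ι (x : 𝔤 X n) (v : V) : act (UniversalEnvelopingAlgebra.ι ℂ x) v = ⁅x, v⁆ := by
  rw [act, UniversalEnvelopingAlgebra.lift_ι_apply]; rfl

variable (X n V) in
/-- The operators of the generators `e_i` on a module. -/
def eOp (i : Node n) : Module.End ℂ V := LieModule.toEnd ℂ (𝔤 X n) V (e X i)

variable (X n V) in
/-- The operators of the generators `f_i` on a module. -/
def fOp (i : Node n) : Module.End ℂ V := LieModule.toEnd ℂ (𝔤 X n) V (f X i)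

variable (X n V) in
/-- The operators of the coroots `h_i` on a module. -/
def hOp (i : Node n) : Module.End ℂ V := LieModule.toEnd ℂ (𝔤 X n) V (h X i)

lemma act_e (i : Node n) (v : V) :
    act (UniversalEnvelopingAlgebra.ι ℂ (e X i)) v = eOp X n V i v := act_ι _ _

lemma act_f (i : Node n) (v : V) :
    act (UniversalEnvelopingAlgebra.ι ℂ (f X i)) v = fOp X n V i v := act_ι _ _

lemma act_h (i : Node n) (v : V) :
    act (UniversalEnvelopingAlgebra.ι ℂ (h X i)) v = hOp X n V i v := act_ι _ _

lemma hasWeight_iff {μ : Node n → ℂ} {v : V} : HasWeight X μ v ↔ IsWt (hOp X n V) μ v := Iff.rfl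

lemma lowerWeight_eq (μ : Node n → ℂ) (m : Node n → ℕ) :
    lowerWeight X μ m = shift (cartanMatrix X n) μ (-fun i => (m i : ℤ)) := by
  ext i
  simp [lowerWeight, shift, sub_eq_add_neg, mul_comm]

lemma lowerSpan_eq (μ : Node n → ℂ) :
    lowerSpan X μ V = Submodule.span ℂ
      {z | ∃ ν, (∃ m : Node n → ℕ, m ≠ 0 ∧
        ν = shift (cartanMatrix X n) μ (-fun i => (m i : ℤ))) ∧ IsWt (hOp X n V) ν z} := by
  rw [lowerSpan]
  congr 1
  ext v
  constructor
  · rintro ⟨m, hm, hv⟩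
    exact ⟨_, ⟨m, hm, rfl⟩, by rwa [← lowerWeight_eq]⟩
  · rintro ⟨_, ⟨m, hm, rfl⟩, hv⟩
    exact ⟨m, hm, by rwa [hasWeight_iff, lowerWeight_eq]⟩

lemma chevalleyRep_module : ChevalleyRep (cartanMatrix X n) (eOp X n V) (fOp X n V) (hOp X n V) :=
  chevalleyRep_of_lieHom (LieModule.toEnd ℂ (𝔤 X n) V)

/-- The elements of 𝔤 preserving `P` form a Lie subalgebra containing the generators, so `P` is a
Lie submodule. -/
lemma submodule_eq_top [LieModule.IsIrreducible ℂ (𝔤 X n) V] (P : Submodule ℂ V)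
    (he : ∀ i x, x ∈ P → eOp X n V i x ∈ P) (hf : ∀ i x, x ∈ P → fOp X n V i x ∈ P)
    (hh : ∀ i x, x ∈ P → hOp X n V i x ∈ P) (hP : P ≠ ⊥) : P = ⊤ := by
  let K : LieSubalgebra ℂ (𝔤 X n) :=
    { carrier := {x | ∀ v ∈ P, ⁅x, v⁆ ∈ P}
      zero_mem' := fun v _ => by rw [zero_lie]; exact P.zero_mem
      add_mem' := fun {x y} hx hy v hv => by rw [add_lie]; exact P.add_mem (hx v hv) (hy v hv)
      smul_mem' := fun c x hx v hv => by rw [smul_lie]; exact P.smul_mem c (hx v hv)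
      lie_mem' := fun {x y} hx hy v hv => by
        rw [lie_lie]; exact P.sub_mem (hx _ (hy v hv)) (hy _ (hx v hv)) }
  have hK : K = ⊤ := lieSubalgebra_eq_top K he hf hh
  let N : LieSubmodule ℂ (𝔤 X n) V :=
    { P with
      lie_mem := fun {x v} hv => by
        have : x ∈ K := by rw [hK]; trivial
        exact this v hv }
  rcases eq_bot_or_eq_top N with h0 | h0
  · refine absurd ((Submodule.eq_bot_iff P).2 fun x hx => ?_) hP
    have : x ∈ N := hx
    rw [h0] at this
    exact (LieSubmodule.mem_bot x).1 this
  · refine eq_top_iff.2 fun x _ => ?_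
    have : x ∈ N := by rw [h0]; trivial
    exact this

section
variable {d : Node n → ℤ} {lam : Node n → ℕ} {u : V}

lemma fOp_mem_lowerSpan
    (R : HighestWeightRep (cartanMatrix X n) (eOp X n V) (fOp X n V) (hOp X n V) d lam u)
    (i : Node n) (x : V) : fOp X n V i x ∈ lowerSpan X (fun i => (lam i : ℂ)) V := by
  rw [lowerSpan_eq]
  refine (sup_le ?_ ?_ : _ ≤ (Submodule.span ℂ _).comap (fOp X n V i)) (R.mem_sup x)
  · rw [Submodule.span_singleton_le_iff_mem]
    refine Submodule.subset_span ⟨_, ⟨Pi.single i 1, by simp, ?_⟩, R.h_u.lower R.toChevalleyRep i⟩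
    congr 1
    ext j
    by_cases hij : j = i
    · subst hij; simp
    · simp [hij]
  · refine Submodule.span_le.2 ?_
    rintro z ⟨ν, ⟨m, hm, rfl⟩, hz⟩
    refine Submodule.subset_span ⟨_, ⟨m + Pi.single i 1, ?_, ?_⟩, hz.lower R.toChevalleyRep i⟩
    · intro h0
      have := congrFun h0 i
      simp at this
    · rw [shift_shift]
      congr 1
      ext j
      by_cases hij : j = i
      · subst hij; simp; ring
      · simp [hij]

/-- The expectation value as a linear functional. -/
lemma exists_expectation
    (R : HighestWeightRep (cartanMatrix X n) (eOp X n V) (fOp X n V) (hOp X n V) d lam u) :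
    ∃ E : V →ₗ[ℂ] ℂ, E u = 1 ∧ (∀ i x, E (fOp X n V i x) = 0) ∧
      (∀ i x, E (hOp X n V i x) = lam i * E x) ∧
      ∀ x c, IsExpectation X (fun i => (lam i : ℂ)) u x c ↔ c = E x := by
  have hu := R.u_notMem
  rw [← lowerSpan_eq] at hu
  -- A functional that kills the lower weight vectors but not `u`; after scaling it is the
  -- expectation value.
  obtain ⟨E', hE', hE0⟩ := Submodule.exists_le_ker_of_notMem hu
  have hdec (x : V) : ∃ c : ℂ, ∃ z ∈ lowerSpan X (fun i => (lam i : ℂ)) V, x = c • u + z := by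
    have hx := R.mem_sup x
    rw [← lowerSpan_eq] at hx
    obtain ⟨_, ha, z, hz, rfl⟩ := Submodule.mem_sup.1 hx
    obtain ⟨c, rfl⟩ := Submodule.mem_span_singleton.1 ha
    exact ⟨c, z, hz, rfl⟩
  have hu1 : ((E' u)⁻¹ • E') u = 1 := by simp [hE']
  have hz0 (z : V) (hz : z ∈ lowerSpan X (fun i => (lam i : ℂ)) V) : ((E' u)⁻¹ • E') z = 0 := by
    rw [LinearMap.smul_apply, LinearMap.mem_ker.1 (hE0 hz), smul_zero]
  generalize (E' u)⁻¹ • E' = E at hu1 hz0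
  refine ⟨E, hu1, fun i x => hz0 _ (fOp_mem_lowerSpan R i x), fun i x => ?_, fun x c => ?_⟩
  · obtain ⟨c, z, hz, rfl⟩ := hdec x
    have h1 : hOp X n V i z ∈ lowerSpan X (fun i => (lam i : ℂ)) V := by
      refine (Submodule.span_le.2 ?_ : lowerSpan X (fun i => (lam i : ℂ)) V ≤
        (lowerSpan X (fun i => (lam i : ℂ)) V).comap (hOp X n V i)) hz
      rintro w ⟨m, hm, hw⟩
      change hOp X n V i w ∈ lowerSpan X (fun i => (lam i : ℂ)) V
      rw [hasWeight_iff.1 hw i]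
      exact Submodule.smul_mem _ _ (Submodule.subset_span ⟨m, hm, hw⟩)
    rw [map_add, map_add, map_add, map_smul, map_smul, map_smul, R.h_u i, map_smul, hz0 _ h1,
      hz0 _ hz, hu1]
    simp [mul_comm]
  · constructor
    · intro hc
      have := hz0 _ hc
      rw [map_sub, map_smul, hu1, sub_eq_zero] at this
      simpa using this.symm
    · rintro rfl
      obtain ⟨c, z, hz, rfl⟩ := hdec x
      rw [IsExpectation, map_add, map_smul, hu1, hz0 z hz, smul_eq_mul, mul_one, add_zero,
        add_sub_cancel_left]
      exact hz

/-- The symmetry of `(a, a') ↦ E(ω̂(a) a' u)`. -/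
lemma expectation_omega
    (R : HighestWeightRep (cartanMatrix X n) (eOp X n V) (fOp X n V) (hOp X n V) d lam u)
    {E : V →ₗ[ℂ] ℂ} (hf : ∀ i x, E (fOp X n V i x) = 0)
    (hh : ∀ i x, E (hOp X n V i x) = lam i * E x) (a : U X n) :
    E (act (omega a) u) = E (act a u) := by
  -- For elements of this left ideal both sides of the claim are 0. It contains e_j and h_j -
  -- λ(h_j), so it absorbs everything except words in the f_j.
  let J : Submodule ℂ (U X n) :=
    { carrier := {c | act c u = 0 ∧ ∀ x : V, E (act (omega c) x) = 0}
      zero_mem' := by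
        have h0 : omega (0 : U X n) = 0 := by simpa using omega_smul (X := X) (n := n) 0 0
        have h1 (x : V) : act (0 : U X n) x = 0 := by simp [act]
        exact ⟨h1 u, fun x => by rw [h0, h1, map_zero]⟩
      add_mem' := fun {a b} ha hb => ⟨by rw [act_add, ha.1, hb.1, add_zero],
        fun x => by rw [omega_add, act_add, map_add, ha.2, hb.2, add_zero]⟩
      smul_mem' := fun c a ha => ⟨by rw [act_smul, ha.1, smul_zero],
        fun x => by rw [omega_smul, act_smul, map_smul, ha.2, smul_zero]⟩ }
  have hJ (b c : U X n) (hc : c ∈ J) : b * c ∈ J :=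
    ⟨by rw [act_mul, hc.1, map_zero], fun x => by rw [omega_mul, act_mul, hc.2]⟩
  let L := (Algebra.lmul ℂ (U X n)).toLieHom.comp (UniversalEnvelopingAlgebra.ι ℂ : 𝔤 X n →ₗ⁅ℂ⁆ _)
  have RU := chevalleyRep_of_lieHom L
  let P : Submodule ℂ (U X n) := wordSpan (fun i => L (f X i)) 1 ⊔ J
  have hL (x : 𝔤 X n) (b : U X n) : L x b = UniversalEnvelopingAlgebra.ι ℂ x * b := rfl
  have h1P : (1 : U X n) ∈ P := Submodule.mem_sup_left self_mem_wordSpan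
  have hh1 (j : Node n) : L (h X j) 1 ∈ P := by
    have h1 : UniversalEnvelopingAlgebra.ι ℂ (h X j) - (lam j : ℂ) • 1 ∈ J := by
      rw [sub_eq_add_neg, ← neg_smul]
      refine ⟨?_, fun x => ?_⟩
      · rw [act_add, act_smul, act_one, act_h, R.h_u j, ← add_smul]; simp
      · rw [omega_add, omega_smul, omega_h, omega_one, act_add, act_smul, act_one, act_h, map_add,
          hh, map_smul, smul_eq_mul]; ring
    rw [hL, mul_one, ← sub_add_cancel (UniversalEnvelopingAlgebra.ι ℂ (h X j)) ((lam j : ℂ) • 1)]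
    exact P.add_mem (Submodule.mem_sup_right h1) (P.smul_mem _ h1P)
  have he1 (j : Node n) : L (e X j) 1 ∈ P := by
    refine Submodule.mem_sup_right ?_
    rw [hL, mul_one]
    exact ⟨by rw [act_e, R.e_u], fun x => by rw [omega_e, act_f, hf]⟩
  have hh1' (j : Node n) : (-L (h X j)) 1 ∈ P := P.neg_mem (hh1 j)
  have hfP (j : Node n) (x : U X n) (hx : x ∈ P) : L (f X j) x ∈ P :=
    apply_mem_wordSpan_sup (e := fun i => L (f X i)) (fun i x hx => hJ _ x hx) hx j
  have hhP (j : Node n) (x : U X n) (hx : x ∈ P) : L (h X j) x ∈ P := by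
    have := RU.swap.h_mem_wordSpan_sup (J := J) (v := 1) (fun i x hx => hJ _ x hx)
      (fun i x hx => J.neg_mem (hJ _ x hx)) hh1' j hx
    exact (Submodule.neg_mem_iff P).1 this
  have heP (j : Node n) (x : U X n) (hx : x ∈ P) : L (e X j) x ∈ P :=
    RU.swap.f_mem_wordSpan_sup (J := J) (v := 1) (fun i x hx => hJ _ x hx)
      (fun i x hx => J.neg_mem (hJ _ x hx)) hh1' j (fun x hx => hJ _ x hx) (he1 j) hx
  -- The elements whose left multiplication preserves `P` form a subalgebra containing the
  -- generators. Hence `P` is all of U(𝔤), as it contains 1.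
  let S : Subalgebra ℂ (U X n) :=
    { carrier := {b | ∀ x ∈ P, b * x ∈ P}
      mul_mem' := fun {b c} hb hc x hx => by rw [mul_assoc]; exact hb _ (hc x hx)
      add_mem' := fun {b c} hb hc x hx => by rw [add_mul]; exact P.add_mem (hb x hx) (hc x hx)
      algebraMap_mem' := fun c x hx => by
        rw [← Algebra.smul_def]; exact P.smul_mem c hx }
  have hS : S = ⊤ := subalgebra_eq_top S heP hfP hhP
  have ha : a ∈ P := by
    have h1 : a ∈ S := by rw [hS]; trivial
    simpa using h1 1 h1P
  let Q : Submodule ℂ (U X n) :=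
    { carrier := {c | E (act (omega c) u) = E (act c u)}
      zero_mem' := by
        have h0 : omega (0 : U X n) = 0 := by simpa using omega_smul (X := X) (n := n) 0 0
        change E (act (omega 0) u) = _
        rw [h0]
      add_mem' := fun {a b} ha hb => by
        change E (act (omega (a + b)) u) = E (act (a + b) u)
        rw [omega_add, act_add, act_add, map_add, map_add, ha, hb]
      smul_mem' := fun c a ha => by
        change E (act (omega (c • a)) u) = E (act (c • a) u)
        rw [omega_smul, act_smul, act_smul, map_smul, map_smul, ha] }
  have hPQ : P ≤ Q := by
    refine sup_le (wordSpan_le ?_ fun j x _ => ?_) fun x hx => ?_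
    · change E (act (omega 1) u) = _
      rw [omega_one]
    · change E (act (omega (UniversalEnvelopingAlgebra.ι ℂ (f X j) * x)) u) =
        E (act (UniversalEnvelopingAlgebra.ι ℂ (f X j) * x) u)
      -- For a word starting with f_j both sides vanish: ω̂ turns f_j into e_j acting first on `u`,
      -- and E kills the image of f_j.
      rw [omega_mul, omega_f, act_mul, act_mul, act_e, R.e_u, map_zero, map_zero, act_f, hf]
    · change E (act (omega x) u) = E (act x u)
      rw [hx.1, hx.2, map_zero]
  exact hPQ ha

lemma exists_act_eq
    (R : HighestWeightRep (cartanMatrix X n) (eOp X n V) (fOp X n V) (hOp X n V) d lam u) (x : V) :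
    ∃ a : U X n, act a u = x := by
  let φ : U X n →ₗ[ℂ] V :=
    { toFun a := act a u
      map_add' a b := act_add a b u
      map_smul' c a := act_smul c a u }
  have h1 : wordSpan (fOp X n V) u ≤ LinearMap.range φ := by
    refine wordSpan_le ⟨1, act_one u⟩ ?_
    rintro j _ ⟨a, rfl⟩
    exact ⟨UniversalEnvelopingAlgebra.ι ℂ (f X j) * a, by
      change act _ u = _; rw [act_mul, act_f]; rfl⟩
  exact h1 (R.wordSpan_f_u ▸ Submodule.mem_top)

/-- The candidate is ⟨a u, y⟩ = E(ω̂(a) y). It is well defined because E(ω̂(a) b u) = E(ω̂(b) a u),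
so the value depends on `a` only through a u. -/
lemma existsUnique_form
    (R : HighestWeightRep (cartanMatrix X n) (eOp X n V) (fOp X n V) (hOp X n V) d lam u) :
    ∃! B : LinearMap.BilinForm ℂ V, IsInvariantForm X (fun i => (lam i : ℂ)) u B := by
  obtain ⟨E, -, hf, hh, hE⟩ := exists_expectation R
  choose s hs using exists_act_eq R
  have key (a b : U X n) (x : V) (hab : act a u = act b u) :
      E (act (omega a) x) = E (act (omega b) x) := by
    rw [← hs x, ← act_mul, ← act_mul, ← omega_omega (s x), ← omega_mul, ← omega_mul,
      expectation_omega R hf hh, expectation_omega R hf hh, act_mul, act_mul, hab]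
  let B : LinearMap.BilinForm ℂ V := LinearMap.mk₂ ℂ (fun x y => E (act (omega (s x)) y))
    (fun x x' y => by
      rw [← map_add, ← LinearMap.add_apply, key (s (x + x')) (s x + s x') y
        (by rw [hs, act_add, hs, hs]), omega_add, act_add, LinearMap.add_apply])
    (fun c x y => by
      rw [key (s (c • x)) (c • s x) y (by rw [hs, act_smul, hs]), omega_smul, act_smul, map_smul])
    (fun x y y' => by rw [map_add, map_add])
    (fun c x y => by rw [map_smul, map_smul])
  refine ⟨B, fun a a' => (hE _ _).2 ?_, fun B' hB' => ?_⟩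
  · change E (act (omega (s (act a u))) (act a' u)) = _
    rw [key _ a _ (hs _), act_mul]
  · ext x y
    have h1 := (hE _ _).1 (hB' (s x) (s y))
    rw [hs, hs, act_mul, hs] at h1
    exact h1

lemma isContravariant_of_isInvariantForm
    (R : HighestWeightRep (cartanMatrix X n) (eOp X n V) (fOp X n V) (hOp X n V) d lam u)
    {B : LinearMap.BilinForm ℂ V} (hB : IsInvariantForm X (fun i => (lam i : ℂ)) u B) :
    IsContravariant (eOp X n V) (fOp X n V) (hOp X n V) u B := by
  obtain ⟨E, hu, -, -, hE⟩ := exists_expectation R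
  have hB' (a a' : U X n) : B (act a u) (act a' u) = E (act (omega a * a') u) :=
    (hE _ _).1 (hB a a')
  refine ⟨fun i x y => ?_, fun i x y => ?_, ?_⟩
  · obtain ⟨a, rfl⟩ := exists_act_eq R x
    obtain ⟨b, rfl⟩ := exists_act_eq R y
    rw [← act_f, ← act_mul, ← act_e, ← act_mul, hB', hB', omega_mul, omega_f, mul_assoc]
  · obtain ⟨a, rfl⟩ := exists_act_eq R x
    obtain ⟨b, rfl⟩ := exists_act_eq R y
    rw [← act_h, ← act_mul, ← act_h, ← act_mul, hB', hB', omega_mul, omega_h, mul_assoc]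
  · have := hB' 1 1
    rwa [act_one, omega_one, one_mul, act_one, hu] at this

end

end Form

/-! ### The classical Cartan matrices -/

section Cartan

/-- Integers proportional to the squared lengths of the simple roots. -/
def rootLength (X : ClassicalType) (n j : ℕ) : ℤ :=
  match X with
  | .A | .D => 1
  | .B => if j = n then 1 else 2
  | .C => if j = n then 2 else 1

lemma rootLength_pos (X : ClassicalType) (n j : ℕ) : 0 < rootLength X n j := by
  cases X <;> simp only [rootLength] <;> (try split_ifs) <;> norm_num

lemma cartanEntry_self (X : ClassicalType) (n i : ℕ) : cartanEntry X n i i = 2 := by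
  simp [cartanEntry]

lemma rootLength_mul_cartanEntry (X : ClassicalType) {n i j : ℕ} (hi : i ≤ n) (hj : j ≤ n) :
    rootLength X n i * cartanEntry X n i j = rootLength X n j * cartanEntry X n j i := by
  cases X <;> simp only [rootLength, cartanEntry] <;> grind

/-- The deviation of the rows of the Cartan matrix from those of type `A_n`. -/
def cartanCorrection (X : ClassicalType) (n i : ℕ) (M : ℕ → ℤ) : ℤ :=
  match X with
  | .A => 0
  | .B => if i = n then -M (n - 1) else 0
  | .C => if i + 1 = n then -M n else 0
  | .D => if i + 2 = n then -M n else if i + 1 = n then M n else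
      if i = n then M (n - 1) - M (n - 2) else 0

/-- Extending `M` by zero lets the boundary rows and small ranks share one formula: a second
difference plus a correction at the special end of the diagram. -/
lemma sum_cartanEntry_mul {X : ClassicalType} {n i : ℕ} (hn : X = .D → 2 ≤ n)
    (hi : i ∈ Finset.Icc 1 n) {M : ℕ → ℤ} (hM : ∀ k, k ∉ Finset.Icc 1 n → M k = 0) :
    ∑ j ∈ Finset.Icc 1 n, cartanEntry X n i j * M j =
      2 * M i - M (i - 1) - M (i + 1) + cartanCorrection X n i M := by
  have hS (c : ℤ) (k : ℕ) : ∑ j ∈ Finset.Icc 1 n, (if j = k then c * M j else 0) = c * M k := by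
    by_cases hk : k ∈ Finset.Icc 1 n
    · rw [Finset.sum_ite_eq' _ k fun j => c * M j, if_pos hk]
    · rw [hM k hk, mul_zero]
      exact Finset.sum_eq_zero fun j hj => if_neg (by rintro rfl; exact hk hj)
  have hc (c : Prop) [Decidable c] (F : ℕ → ℤ) :
      ∑ j ∈ Finset.Icc 1 n, (if c then F j else 0) =
        if c then ∑ j ∈ Finset.Icc 1 n, F j else 0 := by
    split_ifs <;> simp
  have hi' := Finset.mem_Icc.1 hi
  have h1 (j : ℕ) (hj : j ∈ Finset.Icc 1 n) : cartanEntry X n i j * M j =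
      (if j = i then 2 * M j else 0) + (if j = i - 1 then (-1) * M j else 0) +
      (if j = i + 1 then (-1) * M j else 0) +
      match X with
      | .A => 0
      | .B => if i = n then (if j = n - 1 then (-1) * M j else 0) else 0
      | .C => if i + 1 = n then (if j = n then (-1) * M j else 0) else 0
      | .D => (if i + 2 = n then (if j = n then (-1) * M j else 0) else 0) +
          (if i + 1 = n then (if j = n then 1 * M j else 0) else 0) +
          (if i = n then (if j = n - 1 then 1 * M j else 0) +
            (if j = n - 2 then (-1) * M j else 0) else 0) := by
    have hj' := Finset.mem_Icc.1 hj
    cases X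
    · simp only [cartanEntry]; grind
    · simp only [cartanEntry]; grind
    · simp only [cartanEntry]; grind
    · have := hn rfl
      clear hS hc hM hi hj hn
      simp only [cartanEntry]
      grind (splits := 20)
  rw [Finset.sum_congr rfl h1]
  cases X
  · simp only [Finset.sum_add_distrib, hS, cartanCorrection, Finset.sum_const_zero]; ring
  · simp only [Finset.sum_add_distrib, hS, hc, cartanCorrection]; split_ifs <;> ring
  · simp only [Finset.sum_add_distrib, hS, hc, cartanCorrection]; split_ifs <;> ring
  · simp only [Finset.sum_add_distrib, hS, hc, cartanCorrection]
    split_ifs <;> omega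

lemma eq_mul_of_second_difference {M : ℕ → ℤ} (N : ℕ) (h0 : M 0 = 0)
    (h : ∀ k, 1 ≤ k → k < N → 2 * M k = M (k - 1) + M (k + 1)) : ∀ k ≤ N, M k = k * M 1 := by
  intro k
  induction k using Nat.strong_induction_on with
  | _ k ih =>
  intro hk
  match k, ih, hk with
  | 0, _, _ => simp [h0]
  | 1, _, _ => simp
  | k + 2, ih, hk =>
    have h1 := h (k + 1) (by omega) (by omega)
    rw [ih (k + 1) (by omega) (by omega), Nat.add_sub_cancel, ih k (by omega) (by omega)] at h1
    push_cast at h1 ⊢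
    linear_combination -h1

/-- Away from the special end the rows say that `M` has vanishing second differences, so M k = k M 1
there. The remaining rows force the slope to be 0. In types C and D one of these rows is absent in
the lowest rank, hence the separate cases there. -/
lemma eq_zero_of_cartan {X : ClassicalType} {n : ℕ} (hn : X = .D → 2 ≤ n) {M : ℕ → ℤ}
    (hM : ∀ k, k ∉ Finset.Icc 1 n → M k = 0)
    (h : ∀ i ∈ Finset.Icc 1 n, ∑ j ∈ Finset.Icc 1 n, cartanEntry X n i j * M j = 0) (k : ℕ) :
    M k = 0 := by
  have h0 : M 0 = 0 := hM 0 (by simp)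
  have hn1 : M (n + 1) = 0 := hM _ (by simp)
  have hrow (i : ℕ) (h1 : 1 ≤ i) (h2 : i ≤ n) :
      2 * M i - M (i - 1) - M (i + 1) + cartanCorrection X n i M = 0 := by
    have hi := Finset.mem_Icc.2 ⟨h1, h2⟩
    rw [← sum_cartanEntry_mul hn hi hM, h i hi]
  by_cases hk : k ∈ Finset.Icc 1 n
  swap
  · exact hM k hk
  obtain ⟨hk1, hk2⟩ := Finset.mem_Icc.1 hk
  cases X with
  | A =>
    have hlin := eq_mul_of_second_difference (M := M) (n + 1) h0 fun k h1 h2 => by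
      have := hrow k h1 (by omega)
      simp only [cartanCorrection] at this
      omega
    have h1 := hlin (n + 1) le_rfl
    rw [hn1, eq_comm, mul_eq_zero] at h1
    have hM1 : M 1 = 0 := h1.resolve_left (by positivity)
    rw [hlin k (by omega), hM1, mul_zero]
  | B =>
    have hlin := eq_mul_of_second_difference (M := M) n h0 fun k h1 h2 => by
      have := hrow k h1 (by omega)
      simp only [cartanCorrection, if_neg h2.ne] at this
      omega
    obtain ⟨n, rfl⟩ : ∃ n', n = n' + 1 := ⟨n - 1, by omega⟩
    have h1 := hrow (n + 1) (by omega) le_rfl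
    simp only [cartanCorrection, if_true, Nat.add_sub_cancel, hn1] at h1
    rw [hlin (n + 1) le_rfl, hlin n (by omega)] at h1
    have hM1 : M 1 = 0 := by push_cast at h1; linarith
    rw [hlin k (by omega), hM1, mul_zero]
  | C =>
    have hlin := eq_mul_of_second_difference (M := M) (n - 1) h0 fun k h1 h2 => by
      have := hrow k h1 (by omega)
      simp only [cartanCorrection, if_neg (show k + 1 ≠ n by omega)] at this
      omega
    obtain ⟨n, rfl⟩ : ∃ n', n = n' + 1 := ⟨n - 1, by omega⟩
    have h1 := hrow (n + 1) (by omega) le_rfl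
    simp only [cartanCorrection, Nat.add_sub_cancel, hn1] at h1
    rw [if_neg (by omega), hlin n (by omega)] at h1
    have hM1 : n ≠ 0 → M 1 = 0 := by
      intro hn0
      obtain ⟨n, rfl⟩ : ∃ n', n = n' + 1 := ⟨n - 1, by omega⟩
      have h2 := hrow (n + 1) (by omega) (by omega)
      simp only [cartanCorrection, Nat.add_sub_cancel, if_true] at h2
      rw [hlin (n + 1) (by omega), hlin n (by omega)] at h2
      push_cast at h1 h2
      linarith
    have h3 : (n : ℤ) * M 1 = 0 := by
      rcases eq_or_ne n 0 with rfl | hn0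
      · simp
      · rw [hM1 hn0, mul_zero]
    rcases Nat.lt_or_ge k (n + 1) with hlt | hge
    · rw [hlin k (by omega), hM1 (by omega), mul_zero]
    · rw [show k = n + 1 by omega]; linarith
  | D =>
    have hn' := hn rfl
    have hlin := eq_mul_of_second_difference (M := M) (n - 2) h0 fun k h1 h2 => by
      have := hrow k h1 (by omega)
      simp only [cartanCorrection, if_neg (show k + 2 ≠ n by omega),
        if_neg (show k + 1 ≠ n by omega), if_neg (show k ≠ n by omega)] at this
      omega
    obtain ⟨n, rfl⟩ : ∃ n', n = n' + 2 := ⟨n - 2, by omega⟩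
    have h1 := hrow (n + 2) (by omega) le_rfl
    have h2 := hrow (n + 1) (by omega) (by omega)
    simp only [cartanCorrection, show n + 2 - 1 = n + 1 by omega, Nat.add_sub_cancel, hn1] at h1 h2
    simp only [Nat.add_eq_left, Nat.add_left_cancel_iff, if_true] at h1 h2
    rw [hlin n (by omega)] at h1 h2
    simp at h1 h2
    have hM1 : n ≠ 0 → M 1 = 0 := by
      intro hn0
      obtain ⟨n, rfl⟩ : ∃ n', n = n' + 1 := ⟨n - 1, by omega⟩
      have h3 := hrow (n + 1) (by omega) (by omega)
      simp only [cartanCorrection, Nat.add_sub_cancel, if_true] at h3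
      rw [hlin (n + 1) (by omega), hlin n (by omega)] at h3
      push_cast at h1 h2 h3
      linarith
    have h3 : (n : ℤ) * M 1 = 0 := by
      rcases eq_or_ne n 0 with rfl | hn0
      · simp
      · rw [hM1 hn0, mul_zero]
    rcases Nat.lt_or_ge k (n + 1) with hlt | hge
    · rw [hlin k (by omega), hM1 (by omega), mul_zero]
    · rcases Nat.lt_or_ge k (n + 2) with hlt | hge
      · rw [show k = n + 1 by omega]; linarith
      · rw [show k = n + 2 by omega]; linarith

lemma cartanMatrix_nondegenerate {X : ClassicalType} {n : ℕ} (hn : X = .D → 2 ≤ n)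
    (m : Node n → ℤ) (hm : ∀ i, ∑ j, cartanMatrix X n i j * m j = 0) : m = 0 := by
  let M : ℕ → ℤ := fun k => if hk : k ∈ Finset.Icc 1 n then m ⟨k, hk⟩ else 0
  have hMm (j : Node n) : M j = m j := dif_pos j.2
  have h1 := eq_zero_of_cartan (M := M) hn (fun k hk => dif_neg hk) fun i hi => by
    rw [← hm ⟨i, hi⟩, ← Finset.sum_coe_sort]
    exact Finset.sum_congr rfl fun j _ => by rw [hMm]; rfl
  ext j
  rw [← hMm, h1]; rfl

end Cartan

/-! ### Weights in orthogonal coordinates -/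

section Coordinates

/-- The value at `h_l` of the weight with coordinates `x`. -/
def pairing (X : ClassicalType) (n l : ℕ) (x : ℕ → ℚ) : ℚ :=
  match X with
  | .A => x l - x (l + 1)
  | .B => if l = n then 2 * x n else x l - x (l + 1)
  | .C => if l = n then x n else x l - x (l + 1)
  | .D => if l = n then x (n - 1) + x n else x l - x (l + 1)

/-- The transposition of the coordinates `j` and `j + 1`. -/
def swapCoord (j : ℕ) (x : ℕ → ℚ) : ℕ → ℚ :=
  fun k => if k = j then x (j + 1) else if k = j + 1 then x j else x k

/-- The simple reflection `s_j` in coordinates. -/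
def reflection (X : ClassicalType) (n j : ℕ) (x : ℕ → ℚ) (k : ℕ) : ℚ :=
  match X with
  | .A => swapCoord j x k
  | .B | .C => if j = n then if k = n then -x n else x k else swapCoord j x k
  | .D => if j = n then if k = n then -x (n - 1) else if k = n - 1 then -x n else x k
      else swapCoord j x k

/-- In coordinates s_j is x ↦ x - x(h_j) α_j, and the Cartan entry is α_j(h_l). -/
lemma pairing_reflection {X : ClassicalType} {n l j : ℕ} (hn : X = .D → 2 ≤ n)
    (hl : l ∈ Finset.Icc 1 n) (hj : j ∈ Finset.Icc 1 n) (x : ℕ → ℚ) :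
    pairing X n l (reflection X n j x) =
      pairing X n l x - cartanEntry X n l j * pairing X n j x := by
  have hl' := Finset.mem_Icc.1 hl
  have hj' := Finset.mem_Icc.1 hj
  clear hl hj
  cases X
  · simp only [pairing, reflection, cartanEntry, swapCoord, apply_ite (Int.cast : ℤ → ℚ)]
    push_cast
    grind (splits := 20)
  · simp only [pairing, reflection, cartanEntry, swapCoord, apply_ite (Int.cast : ℤ → ℚ)]
    push_cast
    grind (splits := 20)
  · simp only [pairing, reflection, cartanEntry, swapCoord, apply_ite (Int.cast : ℤ → ℚ)]
    push_cast
    grind (splits := 20)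
  · have := hn rfl
    simp only [pairing, reflection, cartanEntry, swapCoord, apply_ite (Int.cast : ℤ → ℚ)]
    push_cast
    grind (splits := 25)

/-- The word `w` of pairs (label `j`, exponent `p`), read from the right, leads from `x` to `x'` by
simple reflections, where `p` is the value of the current weight at `h_j`. -/
inductive CoordPath (X : ClassicalType) (n : ℕ) (x : ℕ → ℚ) : List (ℕ × ℕ) → (ℕ → ℚ) → Prop
  | nil : CoordPath X n x [] x
  | cons {w : List (ℕ × ℕ)} {x' : ℕ → ℚ} {j p : ℕ} : CoordPath X n x w x' → j ∈ Finset.Icc 1 n →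
      pairing X n j x' = p → CoordPath X n x ((j, p) :: w) (reflection X n j x')

variable {X : ClassicalType} {n : ℕ}

lemma CoordPath.append {x x' x'' : ℕ → ℚ} {w w' : List (ℕ × ℕ)} (h : CoordPath X n x w x')
    (h' : CoordPath X n x' w' x'') : CoordPath X n x (w' ++ w) x'' := by
  induction h' with
  | nil => exact h
  | cons _ hj hp ih => exact ih.cons hj hp

/-- Coordinates are rational because spin weights are half-integral, but their values at the h_l
stay integral along the path. -/
lemma CoordPath.weightPath (hn : X = .D → 2 ≤ n) {x x' : ℕ → ℚ} {w : List (ℕ × ℕ)}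
    (hw : CoordPath X n x w x') {lam : Node n → ℤ} (hlam : ∀ l : Node n, (lam l : ℚ) = pairing X n l x)
    (lab : ℕ → Node n) (hlab : ∀ j ∈ Finset.Icc 1 n, (lab j : ℕ) = j) :
    ∃ μ : Node n → ℤ, (∀ l : Node n, (μ l : ℚ) = pairing X n l x') ∧
      WeightPath (cartanMatrix X n) lam (w.map fun t => (lab t.1, t.2)) μ := by
  induction hw with
  | nil => exact ⟨lam, hlam, .nil⟩
  | @cons w x' j p _ hj hp ih =>
    obtain ⟨μ, hμ, hpath⟩ := ih
    refine ⟨fun l => μ l - cartanMatrix X n l (lab j) * p, fun l => ?_,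
      hpath.cons (i := lab j) ?_ fun _ => rfl⟩
    · have h1 : cartanMatrix X n l (lab j) = cartanEntry X n l j := by
        change cartanEntry X n l (lab j) = _
        rw [hlab j hj]
      rw [pairing_reflection hn l.2 hj, hp, ← hμ, ← h1]
      push_cast
      rfl
    · have h1 := hμ (lab j)
      rw [hlab j hj, hp] at h1
      exact_mod_cast h1

/-- Words are read from the right, so labels increasing in time appear as a reversed list. -/
lemma coordPath_climb {S : ℕ → ℕ → ℚ} {p : ℕ → ℕ} {k s : ℕ}
    (h : ∀ j, k ≤ j → j < k + s → j ∈ Finset.Icc 1 n ∧ pairing X n j (S j) = p j ∧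
      reflection X n j (S j) = S (j + 1)) :
    CoordPath X n (S k) ((List.range' k s).reverse.map fun j => (j, p j)) (S (k + s)) := by
  induction s with
  | zero => exact .nil
  | succ s ih =>
    obtain ⟨h1, h2, h3⟩ := h (k + s) (by omega) (by omega)
    rw [List.range'_1_concat, List.reverse_append, List.reverse_singleton, List.singleton_append,
      List.map_cons, ← add_assoc, ← h3]
    exact (ih fun j hj hj' => h j hj (by omega)).cons h1 h2

lemma coordPath_descend {S : ℕ → ℕ → ℚ} {p : ℕ → ℕ} {k s : ℕ}
    (h : ∀ j, k ≤ j → j < k + s → j ∈ Finset.Icc 1 n ∧ pairing X n j (S (j + 1)) = p j ∧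
      reflection X n j (S (j + 1)) = S j) :
    CoordPath X n (S (k + s)) ((List.range' k s).map fun j => (j, p j)) (S k) := by
  induction s generalizing k with
  | zero => exact .nil
  | succ s ih =>
    obtain ⟨h1, h2, h3⟩ := h k le_rfl (by omega)
    rw [List.range'_succ, List.map_cons, ← h3, show k + (s + 1) = k + 1 + s by ring]
    exact (ih fun j hj hj' => h j (by omega) (by omega)).cons h1 h2

/-- `S k` is the state before block `k` acts; the blocks act in the order N, ..., 1, again because
words are read from the right. -/
lemma coordPath_blocks {S : ℕ → ℕ → ℚ} {blk : ℕ → List (ℕ × ℕ)} {N : ℕ}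
    (h : ∀ k, 1 ≤ k → k ≤ N → CoordPath X n (S k) (blk k) (S (k - 1))) :
    CoordPath X n (S N) ((upTo 1 N).flatMap blk) (S 0) := by
  induction N with
  | zero => exact .nil
  | succ N ih =>
    have h1 := (h (N + 1) (by omega) le_rfl).append (ih fun k hk hk' => h k hk (by omega))
    have h2 : upTo 1 (N + 1) = upTo 1 N ++ [N + 1] := by
      simp only [upTo, Nat.add_sub_cancel, List.range'_1_concat, add_comm 1 N]
    rw [h2, List.flatMap_append]
    simpa using h1

/-- The sequence `lam 1, ..., lam (k - 1), ν (k + 1), ..., ν j, c, ν (j + 1), ...` where `c` is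
entry number `j`. -/
def insertAt (lam ν : ℕ → ℚ) (c : ℚ) (k j : ℕ) : ℕ → ℚ :=
  fun l => if l < k then lam l else if l < j then ν (l + 1) else if l = j then c else ν l

lemma swapCoord_insertAt {lam ν : ℕ → ℚ} {c : ℚ} {k j : ℕ} (hk : k ≤ j) :
    swapCoord j (insertAt lam ν c k j) = insertAt lam ν c k (j + 1) := by
  ext l; simp only [swapCoord, insertAt]; grind

lemma swapCoord_insertAt_succ {lam ν : ℕ → ℚ} {c : ℚ} {k j : ℕ} (hk : k ≤ j) :
    swapCoord j (insertAt lam ν c k (j + 1)) = insertAt lam ν c k j := by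
  ext l; simp only [swapCoord, insertAt]; grind

lemma reflection_eq_swapCoord {j : ℕ} (hj : X = .A ∨ j < n) (x : ℕ → ℚ) :
    reflection X n j x = swapCoord j x := by
  ext k
  cases X <;> simp only [reflection] <;> rw [if_neg] <;> simp_all <;> omega

lemma pairing_eq_sub {j : ℕ} (hj : X = .A ∨ j < n) (x : ℕ → ℚ) :
    pairing X n j x = x j - x (j + 1) := by
  cases X <;> simp only [pairing] <;> rw [if_neg] <;> simp_all <;> omega

lemma pairing_insertAt {lam ν : ℕ → ℚ} {c : ℚ} {k j : ℕ} (hk : k ≤ j) (hj : X = .A ∨ j < n) :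
    pairing X n j (insertAt lam ν c k j) = c - ν (j + 1) := by
  rw [pairing_eq_sub hj]; simp only [insertAt]; grind

lemma pairing_insertAt_succ {lam ν : ℕ → ℚ} {c : ℚ} {k j : ℕ} (hk : k ≤ j) (hj : X = .A ∨ j < n) :
    pairing X n j (insertAt lam ν c k (j + 1)) = ν (j + 1) - c := by
  rw [pairing_eq_sub hj]; simp only [insertAt]; grind

lemma coordPath_insertAt_climb {lam ν : ℕ → ℚ} {c : ℚ} {p : ℕ → ℕ} {k s : ℕ} (hk : 1 ≤ k)
    (hs : (X = .A ∧ k + s ≤ n + 1) ∨ k + s ≤ n)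
    (hp : ∀ j, k ≤ j → j < k + s → (p j : ℚ) = c - ν (j + 1)) :
    CoordPath X n (insertAt lam ν c k k) ((List.range' k s).reverse.map fun j => (j, p j))
      (insertAt lam ν c k (k + s)) := by
  refine coordPath_climb (S := insertAt lam ν c k) fun j h1 h2 => ?_
  have hj : X = .A ∨ j < n := hs.imp And.left (by omega)
  refine ⟨Finset.mem_Icc.2 ⟨by omega, ?_⟩, ?_, ?_⟩
  · rcases hs with ⟨-, hs⟩ | hs <;> omega
  · rw [pairing_insertAt h1 hj, hp j h1 h2]
  · rw [reflection_eq_swapCoord hj, swapCoord_insertAt h1]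

lemma coordPath_insertAt_descend {lam ν : ℕ → ℚ} {c : ℚ} {p : ℕ → ℕ} {k s : ℕ} (hk : 1 ≤ k)
    (hs : k + s ≤ n) (hp : ∀ j, k ≤ j → j < k + s → (p j : ℚ) = ν (j + 1) - c) :
    CoordPath X n (insertAt lam ν c k (k + s)) ((List.range' k s).map fun j => (j, p j))
      (insertAt lam ν c k k) := by
  refine coordPath_descend (S := insertAt lam ν c k) fun j h1 h2 => ?_
  have hj : X = .A ∨ j < n := Or.inr (by omega)
  refine ⟨Finset.mem_Icc.2 ⟨by omega, by omega⟩, ?_, ?_⟩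
  · rw [pairing_insertAt_succ h1 hj, hp j h1 h2]
  · rw [reflection_eq_swapCoord hj, swapCoord_insertAt_succ h1]

end Coordinates

/-! ### The longest words -/

section Words

/-- The word `longestWord` with coordinates in an arbitrary type. -/
def genWord {α : Type*} (X : ClassicalType) (n : ℕ) (a b : ℕ → ℕ → α) : List (ℕ × α) :=
  match X with
  | .A => (upTo 1 n).flatMap fun k => (upTo k n).reverse.map fun j => (j, a k j)
  | .B | .C => (upTo 1 n).flatMap fun k =>
      ((upTo k n).map fun j => (j, a k j)) ++ (upTo k (n - 1)).reverse.map fun j => (j, b k j)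
  | .D => (upTo 1 (n - 1)).flatMap fun k =>
      ((upTo k (n - 1)).map fun j => (j, a k j)) ++ [(n, b k (n - 1))] ++
        (upTo k (n - 2)).reverse.map fun j => (j, b k j)

lemma longestWord_eq (X : ClassicalType) (n : ℕ) (a b : ℕ → ℕ → ℂ) :
    longestWord X n a b = genWord X n a b := by
  cases X <;> rfl

lemma map_genWord {α β : Type*} (g : α → β) (X : ClassicalType) (n : ℕ) (a b : ℕ → ℕ → α) :
    (genWord X n a b).map (fun t => (t.1, g t.2)) =
      genWord X n (fun k j => g (a k j)) (fun k j => g (b k j)) := by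
  cases X <;> simp [genWord, List.map_flatMap, Function.comp_def]

variable {n : ℕ}

/-- Before block k the entries λ_{k+1}, ..., λ_{n+1} stand reversed in the positions after k. The
block moves λ_k past all of them to position n + 1, and passing λ_{n+1+k-j} at step j costs the
difference. -/
lemma coordPath_genWord_A {lam : ℕ → ℚ} {pa pb : ℕ → ℕ → ℕ} (hlam : ∀ l, n + 1 < l → lam l = 0)
    (hp : ∀ k j, 1 ≤ k → k ≤ j → j ≤ n → (pa k j : ℚ) = lam k - lam (n + 1 + k - j)) :
    CoordPath .A n lam (genWord .A n pa pb)
      (insertAt lam (fun l => if l ≤ n + 1 then lam (n + 2 - l) else 0) (lam 0) 0 0) := by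
  let ν : ℕ → ℕ → ℚ := fun k l => if l ≤ n + 1 then lam (n + 2 + k - l) else 0
  have h1 := coordPath_blocks (X := .A) (n := n) (N := n)
    (S := fun k => insertAt lam (ν k) (lam k) k k)
    (blk := fun k => (upTo k n).reverse.map fun j => (j, pa k j)) fun k hk hk' => by
      have h2 := coordPath_insertAt_climb (X := .A) (n := n) (lam := lam) (ν := ν k) (c := lam k)
        (p := pa k) (k := k) (s := n + 1 - k) hk (Or.inl ⟨rfl, by omega⟩) fun j h1 h2 => by
          rw [hp k j hk h1 (by omega)]
          simp only [ν, if_pos (show j + 1 ≤ n + 1 by omega)]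
          rw [show n + 2 + k - (j + 1) = n + 1 + k - j by omega]
      -- The state after block k is the state before block k - 1. For k = 1 this involves the
      -- meaningless coordinate 0, which keeps the value `lam 0` throughout.
      have h3 : insertAt lam (ν k) (lam k) k (k + (n + 1 - k)) =
          insertAt lam (ν (k - 1)) (lam (k - 1)) (k - 1) (k - 1) := by
        clear h2 hp hlam
        obtain ⟨k, rfl⟩ : ∃ k', k = k' + 1 := ⟨k - 1, by omega⟩
        rw [Nat.add_sub_of_le (by omega), Nat.add_sub_cancel]
        ext l
        simp only [insertAt, ν]
        rcases Nat.lt_or_ge l (k + 1) with h | h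
        · rw [if_pos h]
          rcases Nat.lt_or_ge l k with h' | h'
          · rw [if_pos h']
          · rw [if_neg (by omega), if_neg (by omega), if_pos (by omega), show l = k by omega]
        · rw [if_neg (by omega), if_neg (show ¬ l < k by omega), if_neg (show ¬ l < k by omega),
            if_neg (show l ≠ k by omega)]
          rcases Nat.lt_trichotomy l (n + 1) with h' | h' | h'
          · rw [if_pos h', if_pos (by omega), if_pos (by omega)]
            congr 1
            omega
          · rw [if_neg (by omega), if_pos h', if_pos (by omega)]
            congr 1
            omega
          · rw [if_neg (by omega), if_neg (by omega), if_neg (by omega), if_neg (by omega)]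
      rw [h3] at h2
      exact h2
  have h4 : insertAt lam (ν n) (lam n) n n = lam := by
    clear h1 hp
    ext l
    simp only [insertAt, ν]
    rcases Nat.lt_trichotomy l n with h | h | h
    · rw [if_pos h]
    · rw [if_neg (by omega), if_neg (by omega), if_pos h, h]
    · rw [if_neg (by omega), if_neg (by omega), if_neg (by omega)]
      split_ifs with h'
      · rw [show n + 2 + n - l = l by omega]
      · exact (hlam l (by omega)).symm
  simp only [h4] at h1
  exact h1

/-- Before block k the entries after position k are already negated. The block carries λ_k past them
to position n, changes its sign by s_n, and carries -λ_k back. Climbing gives the sums λ_k +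
λ_{j+1}, descending the differences λ_k - λ_{j+1}. -/
lemma coordPath_genWord_BC {X : ClassicalType} (hX : X = .B ∨ X = .C) {lam : ℕ → ℚ}
    {pa pb : ℕ → ℕ → ℕ} (hlam : ∀ l, n < l → lam l = 0)
    (hb : ∀ k j, 1 ≤ k → k ≤ j → j < n → (pb k j : ℚ) = lam k + lam (j + 1))
    (ha : ∀ k j, 1 ≤ k → k ≤ j → j < n → (pa k j : ℚ) = lam k - lam (j + 1))
    (haB : X = .B → ∀ k, 1 ≤ k → k ≤ n → (pa k n : ℚ) = 2 * lam k)
    (haC : X = .C → ∀ k, 1 ≤ k → k ≤ n → (pa k n : ℚ) = lam k) :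
    CoordPath X n lam (genWord X n pa pb) (insertAt lam (fun l => -lam l) (lam 0) 0 0) := by
  have h1 := coordPath_blocks (X := X) (n := n) (N := n)
    (S := fun k => insertAt lam (fun l => -lam l) (lam k) k k)
    (blk := fun k => ((upTo k n).map fun j => (j, pa k j)) ++
      (upTo k (n - 1)).reverse.map fun j => (j, pb k j)) fun k hk hk' => by
      have hup := coordPath_insertAt_climb (X := X) (n := n) (lam := lam) (ν := fun l => -lam l)
        (c := lam k) (p := pb k) (k := k) (s := n - k) hk (Or.inr (by omega)) fun j h1 h2 => by
          rw [hb k j hk h1 (by omega), sub_neg_eq_add]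
      have hdown := coordPath_insertAt_descend (X := X) (n := n) (lam := lam) (ν := fun l => -lam l)
        (c := -lam k) (p := pa k) (k := k) (s := n - k) hk (by omega) fun j h1 h2 => by
          rw [ha k j hk h1 (by omega)]; ring
      rw [Nat.add_sub_cancel' hk'] at hup hdown
      have hflip : CoordPath X n (insertAt lam (fun l => -lam l) (lam k) k n) [(n, pa k n)]
          (insertAt lam (fun l => -lam l) (-lam k) k n) := by
        have h3 : reflection X n n (insertAt lam (fun l => -lam l) (lam k) k n) =
            insertAt lam (fun l => -lam l) (-lam k) k n := by
          ext l
          rcases hX with rfl | rfl <;> simp only [reflection, insertAt] <;> grind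
        rw [← h3]
        refine CoordPath.nil.cons (Finset.mem_Icc.2 ⟨by omega, le_rfl⟩) ?_
        rcases hX with rfl | rfl
        · rw [haB rfl k hk hk']; simp only [pairing, insertAt]; grind
        · rw [haC rfl k hk hk']; simp only [pairing, insertAt]; grind
      have hall := (hup.append hflip).append hdown
      have hl1 : upTo k n = List.range' k (n - k) ++ [n] := by
        rw [upTo, show n + 1 - k = n - k + 1 by omega, List.range'_1_concat,
          Nat.add_sub_cancel' hk']
      have hl2 : upTo k (n - 1) = List.range' k (n - k) := by
        rw [upTo, show n - 1 + 1 - k = n - k by omega]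
      rw [hl1, hl2, List.map_append, List.map_singleton, List.append_assoc]
      have h5 : insertAt lam (fun l => -lam l) (-lam k) k k =
          insertAt lam (fun l => -lam l) (lam (k - 1)) (k - 1) (k - 1) := by
        ext l
        simp only [insertAt]
        grind
      rw [h5] at hall
      simpa using hall
  have h2 : insertAt lam (fun l => -lam l) (lam n) n n = lam := by
    ext l
    simp only [insertAt]
    grind
  simp only [h2] at h1
  rcases hX with rfl | rfl <;> exact h1

/-- The sign of the last coordinate in type `D_n` after the blocks `k + 1, ..., n - 1`. -/
def lastSign (n k : ℕ) : ℚ := if Even (n - 1 - k) then 1 else -1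

lemma lastSign_pred {k : ℕ} (hk : 1 ≤ k) (hk' : k ≤ n - 1) :
    lastSign n (k - 1) = -lastSign n k := by
  rw [lastSign, lastSign, show n - 1 - (k - 1) = n - 1 - k + 1 by omega]
  by_cases h : Even (n - 1 - k) <;> simp [h, Nat.even_add_one]

/-- As in types B and C, except that s_n exchanges and negates the last two coordinates. Each block
thus also flips the sign of λ_n, which is tracked by `lastSign`. The climb stops at n - 1, and the
descent starts with s_{n-1}. -/
lemma coordPath_genWord_D (hn : 2 ≤ n) {lam : ℕ → ℚ} {pa pb : ℕ → ℕ → ℕ}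
    (hlam : ∀ l, n < l → lam l = 0)
    (hb : ∀ k j, 1 ≤ k → k ≤ j → j + 2 ≤ n → (pb k j : ℚ) = lam k + lam (j + 1))
    (ha : ∀ k j, 1 ≤ k → k ≤ j → j + 2 ≤ n → (pa k j : ℚ) = lam k - lam (j + 1))
    (hbn : ∀ k, 1 ≤ k → k ≤ n - 1 → (pb k (n - 1) : ℚ) = lam k + lastSign n k * lam n)
    (han : ∀ k, 1 ≤ k → k ≤ n - 1 → (pa k (n - 1) : ℚ) = lam k - lastSign n k * lam n) :
    CoordPath .D n lam (genWord .D n pa pb)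
      (insertAt lam (fun l => if l = n then lastSign n 0 * lam n else -lam l) (lam 0) 0 0) := by
  let ν : ℕ → ℕ → ℚ := fun k l => if l = n then lastSign n k * lam n else -lam l
  have h1 := coordPath_blocks (X := .D) (n := n) (N := n - 1)
    (S := fun k => insertAt lam (ν k) (lam k) k k)
    (blk := fun k => ((upTo k (n - 1)).map fun j => (j, pa k j)) ++ [(n, pb k (n - 1))] ++
        (upTo k (n - 2)).reverse.map fun j => (j, pb k j)) fun k hk hk' => by
      have hs := lastSign_pred hk hk'
      have hup := coordPath_insertAt_climb (X := .D) (n := n) (lam := lam) (ν := ν k)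
        (c := lam k) (p := pb k) (k := k) (s := n - 1 - k) hk (Or.inr (by omega)) fun j h1 h2 => by
          rw [hb k j hk h1 (by omega)]
          simp only [ν, if_neg (show j + 1 ≠ n by omega), sub_neg_eq_add]
      have hdown := coordPath_insertAt_descend (X := .D) (n := n) (lam := lam) (ν := ν (k - 1))
        (c := -lam k) (p := pa k) (k := k) (s := n - k) hk (by omega) fun j h1 h2 => by
          by_cases hjn : j + 1 = n
          · rw [show j = n - 1 by omega, han k hk hk']
            simp only [ν, if_pos (show n - 1 + 1 = n by omega), hs]
            ring
          · rw [ha k j hk h1 (by omega)]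
            simp only [ν, if_neg hjn]
            ring
      rw [Nat.add_sub_cancel' (by omega)] at hup hdown
      have hflip : CoordPath .D n (insertAt lam (ν k) (lam k) k (n - 1)) [(n, pb k (n - 1))]
          (insertAt lam (ν (k - 1)) (-lam k) k n) := by
        have h3 : reflection .D n n (insertAt lam (ν k) (lam k) k (n - 1)) =
            insertAt lam (ν (k - 1)) (-lam k) k n := by
          ext l
          simp only [reflection, insertAt, ν, hs]
          grind
        rw [← h3]
        refine CoordPath.nil.cons (Finset.mem_Icc.2 ⟨by omega, le_rfl⟩) ?_
        rw [hbn k hk hk']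
        simp only [pairing, insertAt, ν]
        grind
      have hall := (hup.append hflip).append hdown
      have hl1 : upTo k (n - 1) = List.range' k (n - k) := by
        rw [upTo, show n - 1 + 1 - k = n - k by omega]
      have hl2 : upTo k (n - 2) = List.range' k (n - 1 - k) := by
        rw [upTo, show n - 2 + 1 - k = n - 1 - k by omega]
      rw [hl1, hl2, List.append_assoc]
      have h5 : insertAt lam (ν (k - 1)) (-lam k) k k =
          insertAt lam (ν (k - 1)) (lam (k - 1)) (k - 1) (k - 1) := by
        ext l
        simp only [insertAt, ν]
        grind
      rw [h5] at hall
      exact hall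
  have h2 : insertAt lam (ν (n - 1)) (lam (n - 1)) (n - 1) (n - 1) = lam := by
    have hs : lastSign n (n - 1) = 1 := by simp [lastSign]
    ext l
    simp only [insertAt, ν, hs]
    grind
  simp only [h2] at h1
  exact h1

end Words

/-! ### Products over the letters of the longest word -/

section Products

open Finset

lemma prod_map_range' (F : ℕ → ℂ) (k s : ℕ) :
    ((List.range' k s).map F).prod = ∏ j ∈ Ico k (k + s), F j := by
  induction s with
  | zero => simp
  | succ s ih =>
    rw [List.range'_1_concat, List.map_append, List.prod_append, ih, ← add_assoc,
      prod_Ico_succ_top (by omega)]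
    simp

lemma prod_map_upTo (F : ℕ → ℂ) {k m : ℕ} (h : k ≤ m + 1) :
    ((upTo k m).map F).prod = ∏ j ∈ Ico k (m + 1), F j := by
  rw [upTo, prod_map_range', Nat.add_sub_cancel' h]

lemma prod_map_flatMap {α β : Type*} (l : List α) (g : α → List β) (F : β → ℂ) :
    ((l.flatMap g).map F).prod = (l.map fun k => ((g k).map F).prod).prod := by
  induction l with
  | nil => rfl
  | cons x l ih => simp [ih]

lemma prod_map_upTo_flatMap {β : Type*} (N : ℕ) (g : ℕ → List β) (F : β → ℂ) :
    (((upTo 1 N).flatMap g).map F).prod = ∏ k ∈ Icc 1 N, ((g k).map F).prod := by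
  rw [prod_map_flatMap, prod_map_upTo _ (by omega)]
  rfl

variable {α : Type*} {n : ℕ}

lemma prod_genWord_A (φ : α → ℂ) (a b : ℕ → ℕ → α) :
    ((genWord .A n a b).map fun t => φ t.2).prod =
      ∏ k ∈ Icc 1 n, ∏ j ∈ Icc k n, φ (a k j) := by
  rw [genWord, prod_map_upTo_flatMap]
  refine prod_congr rfl fun k hk => ?_
  have hk' := mem_Icc.1 hk
  rw [List.map_map, List.map_reverse, List.prod_reverse]
  exact prod_map_upTo _ (by omega)

lemma prod_genWord_BC {X : ClassicalType} (hX : X = .B ∨ X = .C) (φ : α → ℂ) (a b : ℕ → ℕ → α) :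
    ((genWord X n a b).map fun t => φ t.2).prod =
      (∏ k ∈ Icc 1 n, ∏ j ∈ Ico k n, φ (a k j)) * (∏ k ∈ Icc 1 n, φ (a k n)) *
        ∏ k ∈ Icc 1 n, ∏ j ∈ Ico k n, φ (b k j) := by
  have h1 : genWord X n a b = (upTo 1 n).flatMap fun k =>
      ((upTo k n).map fun j => (j, a k j)) ++
        (upTo k (n - 1)).reverse.map fun j => (j, b k j) := by
    rcases hX with rfl | rfl <;> rfl
  rw [h1, prod_map_upTo_flatMap, ← prod_mul_distrib, ← prod_mul_distrib]
  refine prod_congr rfl fun k hk => ?_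
  have hk' := mem_Icc.1 hk
  rw [List.map_append, List.prod_append, List.map_map, List.map_map, List.map_reverse,
    List.prod_reverse, prod_map_upTo _ (by omega), prod_map_upTo _ (by omega),
    prod_Ico_succ_top (by omega), Nat.sub_add_cancel (by omega)]
  rfl

lemma prod_genWord_D (φ : α → ℂ) (a b : ℕ → ℕ → α) :
    ((genWord .D n a b).map fun t => φ t.2).prod =
      (∏ k ∈ Icc 1 (n - 1), ∏ j ∈ Ico k n, φ (a k j)) *
        ∏ k ∈ Icc 1 (n - 1), ∏ j ∈ Ico k n, φ (b k j) := by
  rw [genWord, prod_map_upTo_flatMap, ← prod_mul_distrib]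
  refine prod_congr rfl fun k hk => ?_
  have hk' := mem_Icc.1 hk
  have h1 : ∏ j ∈ Ico k n, φ (b k j) = φ (b k (n - 1)) * ∏ j ∈ Ico k (n - 1), φ (b k j) := by
    rw [mul_comm, ← prod_Ico_succ_top (by omega), Nat.sub_add_cancel (by omega)]
  rw [List.map_append, List.map_append, List.prod_append, List.prod_append, List.map_map,
    List.map_map, List.map_reverse, List.prod_reverse, prod_map_upTo _ (by omega),
    prod_map_upTo _ (by omega), Nat.sub_add_cancel (by omega), h1,
    show n - 2 + 1 = n - 1 by omega, List.map_singleton, List.prod_singleton, mul_assoc]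
  rfl

lemma prod_eq_of_subset {s t : Finset ℕ} {F G : ℕ → ℂ} (hst : s ⊆ t) (h1 : ∀ x ∈ s, F x = G x)
    (h0 : ∀ x ∈ t, x ∉ s → F x = 1) : ∏ x ∈ t, F x = ∏ x ∈ s, G x := by
  rw [← prod_subset hst h0]
  exact prod_congr rfl h1

/-- For k ≤ i the exponent is 2 when j < i and 1 when j ≥ i; for k > i it is 0 since j ≥ k. The row
k = i has no squares, so `Ico 1 i` and `Icc 1 i` give the same product there. -/
lemma prod_bar_pow {i N : ℕ} (hN : i ≤ N) (hn : i ≤ n) (b : ℕ → ℕ → ℂ) :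
    ∏ k ∈ Icc 1 N, ∏ j ∈ Ico k n,
        b k j ^ ((if k ≤ i then 1 else 0) + if j + 1 ≤ i then 1 else 0) =
      (∏ k ∈ Icc 1 i, ∏ j ∈ Ico i n, b k j) * ∏ k ∈ Ico 1 i, ∏ j ∈ Ico k i, b k j ^ 2 := by
  have h1 : ∏ k ∈ Ico 1 i, ∏ j ∈ Ico k i, b k j ^ 2 =
      ∏ k ∈ Icc 1 i, ∏ j ∈ Ico k i, b k j ^ 2 := by
    refine (prod_eq_of_subset (fun k hk => ?_) (fun _ _ => rfl) fun k hk hk' => ?_).symm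
    · simp only [mem_Ico, mem_Icc] at *; omega
    · simp only [mem_Ico, mem_Icc] at *
      rw [Ico_eq_empty (by omega), prod_empty]
  rw [h1, ← prod_mul_distrib]
  refine prod_eq_of_subset (Icc_subset_Icc_right hN) (fun k hk => ?_) fun k hk hk' => ?_
  · have hk' := mem_Icc.1 hk
    rw [← prod_Ico_consecutive _ hk'.2 hn, mul_comm]
    congr 1
    · refine prod_congr rfl fun j hj => ?_
      have hj' := mem_Ico.1 hj
      rw [if_pos hk'.2, if_neg (by omega), add_zero, pow_one]
    · refine prod_congr rfl fun j hj => ?_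
      have hj' := mem_Ico.1 hj
      rw [if_pos hk'.2, if_pos (by omega)]
  · simp only [mem_Icc] at hk hk'
    refine prod_eq_one fun j hj => ?_
    have hj' := mem_Ico.1 hj
    rw [if_neg (by omega), if_neg (by omega), add_zero, pow_zero]

lemma prod_pow_ite {i N : ℕ} (hN : i ≤ N) (a : ℕ → ℕ → ℂ) :
    ∏ k ∈ Icc 1 N, ∏ j ∈ Ico k n, a k j ^ (if k ≤ i ∧ i ≤ j then 1 else 0) =
      ∏ k ∈ Icc 1 i, ∏ j ∈ Ico i n, a k j := by
  refine prod_eq_of_subset (Icc_subset_Icc_right hN) (fun k hk => ?_) fun k hk hk' => ?_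
  · have hk' := mem_Icc.1 hk
    refine prod_eq_of_subset (Ico_subset_Ico_left hk'.2) (fun j hj => ?_) fun j hj hj' => ?_
    · rw [if_pos ⟨hk'.2, (mem_Ico.1 hj).1⟩, pow_one]
    · simp only [mem_Ico] at hj hj'
      rw [if_neg (by omega), pow_zero]
  · simp only [mem_Icc] at hk hk'
    exact prod_eq_one fun j hj => by rw [if_neg (by omega), pow_zero]

end Products

/-! ### The exponents of the monomials -/

section Exponents

open Finset

variable {n i : ℕ}

/-- There is a path of weights along the longest word from the fundamental weight `Λ_i` to an
antidominant weight whose exponents are those of the monomial. -/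
def HasMonomialPath (X : ClassicalType) (n i : ℕ) : Prop :=
  ∃ (pa pb : ℕ → ℕ → ℕ) (x x' : ℕ → ℚ), CoordPath X n x (genWord X n pa pb) x' ∧
    (∀ l ∈ Icc 1 n, pairing X n l x = if l = i then 1 else 0) ∧
    (∀ l ∈ Icc 1 n, pairing X n l x' ≤ 0) ∧
    ∀ a b : ℕ → ℕ → ℂ, ((genWord X n (fun k j => (a k j, pa k j)) (fun k j => (b k j, pb k j))).map
      fun t => t.2.1 ^ t.2.2).prod = monomial X n i a b

/-- With Λ_i = (1, ..., 1, 0, ..., 0), i ones, the exponent λ_k - λ_{n+1+k-j} is 1 exactly when k ≤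
i < n + 1 + k - j. -/
lemma hasMonomialPath_A (hi : i ∈ Icc 1 n) : HasMonomialPath .A n i := by
  have hi' := mem_Icc.1 hi
  let pa : ℕ → ℕ → ℕ := fun k j => if k ≤ i ∧ i + j < n + 1 + k then 1 else 0
  let lam : ℕ → ℚ := fun l => if l ≤ i then 1 else 0
  refine ⟨pa, fun _ _ => 0, lam, _, coordPath_genWord_A (fun l hl => if_neg (by omega))
    fun k j h1 h2 h3 => ?_, fun l hl => ?_, fun l hl => ?_, fun a b => ?_⟩
  · simp only [pa, lam]
    rcases Nat.lt_or_ge i k with h | h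
    · rw [if_neg (by omega), if_neg (by omega), if_neg (by omega)]; simp
    · rcases Nat.lt_or_ge (i + j) (n + 1 + k) with h' | h'
      · rw [if_pos ⟨h, h'⟩, if_pos h, if_neg (by omega)]; simp
      · rw [if_neg (by omega), if_pos h, if_pos (by omega)]; simp
  · simp only [pairing, lam]
    have hl' := mem_Icc.1 hl
    grind
  · have hl' := mem_Icc.1 hl
    simp only [pairing, insertAt, lam, Nat.not_lt_zero, if_false, show l ≠ 0 by omega,
      show l + 1 ≠ 0 by omega, show l ≤ n + 1 by omega, show l + 1 ≤ n + 1 by omega, if_true]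
    split_ifs <;> first | (exfalso; omega) | norm_num
  · rw [prod_genWord_A fun t : ℂ × ℕ => t.1 ^ t.2, monomial]
    refine prod_eq_of_subset (Icc_subset_Icc_right hi'.2) (fun k hk => ?_) fun k hk hk' => ?_
    · have hk' := mem_Icc.1 hk
      refine prod_eq_of_subset (Icc_subset_Icc_right (by omega)) (fun j hj => ?_) fun j hj hj' => ?_
      · have hj' := mem_Icc.1 hj
        simp only [pa]
        rw [if_pos (by omega), pow_one]
      · simp only [mem_Icc] at hj hj'
        simp only [pa]
        rw [if_neg (by omega), pow_zero]
    · simp only [mem_Icc] at hk hk'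
      refine prod_eq_one fun j hj => ?_
      simp only [pa]
      rw [if_neg (by omega), pow_zero]

/-- Again Λ_i consists of i ones followed by zeros. The number `c` is the value of the k-th
coordinate vector at the coroot used for the sign change: 2 in type B, where it produces a_{k,n}
ā_{k,n} = a_{k,n}², and 1 in type C. -/
lemma hasMonomialPath_BC {X : ClassicalType} {c : ℕ}
    (hX : (X = .B ∧ c = 2 ∧ i < n) ∨ (X = .C ∧ c = 1)) (hi : i ∈ Icc 1 n) :
    HasMonomialPath X n i := by
  have hi' := mem_Icc.1 hi
  let pa : ℕ → ℕ → ℕ := fun k j =>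
    if j = n then if k ≤ i then c else 0 else if k ≤ i ∧ i ≤ j then 1 else 0
  let pb : ℕ → ℕ → ℕ := fun k j => (if k ≤ i then 1 else 0) + if j + 1 ≤ i then 1 else 0
  let lam : ℕ → ℚ := fun l => if l ≤ i then 1 else 0
  refine ⟨pa, pb, lam, _, coordPath_genWord_BC (hX.imp And.left And.left)
    (fun l hl => if_neg (by omega)) (fun k j h1 h2 h3 => ?_) (fun k j h1 h2 h3 => ?_)
    (fun hB k h1 h2 => ?_) (fun hC k h1 h2 => ?_), fun l hl => ?_, fun l hl => ?_, fun a b => ?_⟩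
  · simp only [pb, lam]
    push_cast
    rfl
  · simp only [pa, lam]
    rw [if_neg (by omega)]
    split_ifs <;> first | (exfalso; omega) | norm_num
  · obtain ⟨-, rfl, -⟩ := hX.resolve_right (by simp [hB])
    simp only [pa, lam, if_true]
    split_ifs <;> norm_num
  · obtain ⟨-, rfl⟩ := hX.resolve_left (by simp [hC])
    simp only [pa, lam, if_true]
    split_ifs <;> norm_num
  · have hl' := mem_Icc.1 hl
    rcases hX with ⟨rfl, rfl, hin⟩ | ⟨rfl, rfl⟩ <;> simp only [pairing, lam] <;>
    split_ifs <;> first | (exfalso; omega) | norm_num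
  · have hl' := mem_Icc.1 hl
    have hn0 : n ≠ 0 := by omega
    rcases hX with ⟨rfl, rfl, hin⟩ | ⟨rfl, rfl⟩ <;>
    simp only [pairing, insertAt, lam, Nat.not_lt_zero, if_false, show l ≠ 0 by omega, hn0,
      show l + 1 ≠ 0 by omega] <;>
    split_ifs <;> first | (exfalso; omega) | norm_num
  · have h1 : ∏ k ∈ Icc 1 n, ∏ j ∈ Ico k n, a k j ^ pa k j =
        ∏ k ∈ Icc 1 i, ∏ j ∈ Ico i n, a k j := by
      rw [← prod_pow_ite hi'.2]
      refine prod_congr rfl fun k _ => prod_congr rfl fun j hj => ?_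
      simp only [pa]
      rw [if_neg (mem_Ico.1 hj).2.ne]
    have h2 : ∏ k ∈ Icc 1 n, a k n ^ pa k n = ∏ k ∈ Icc 1 i, a k n ^ c := by
      refine prod_eq_of_subset (Icc_subset_Icc_right hi'.2) (fun k hk => ?_) fun k hk hk' => ?_
      · simp only [pa, if_true]
        rw [if_pos (mem_Icc.1 hk).2]
      · simp only [mem_Icc] at hk hk'
        simp only [pa, if_true]
        rw [if_neg (by omega), pow_zero]
    have hIcc : Icc i n = Ico i (n + 1) := rfl
    rw [prod_genWord_BC (hX.imp And.left And.left) fun t : ℂ × ℕ => t.1 ^ t.2]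
    simp only [h1, h2]
    simp only [pb]
    rw [prod_bar_pow hi'.2 hi'.2]
    rcases hX with ⟨rfl, rfl, hin⟩ | ⟨rfl, rfl⟩
    · simp only [monomial]
      rw [if_pos hin, ← mul_assoc, ← prod_mul_distrib, ← prod_mul_distrib]
      congr 1
      · refine prod_congr rfl fun k _ => ?_
        rw [hIcc, prod_Ico_succ_top hi'.2, if_pos rfl, prod_mul_distrib,
          prod_congr rfl fun j hj => if_neg (mem_Ico.1 hj).2.ne]
        ring
      · refine prod_congr rfl fun k _ => prod_congr rfl fun j hj => ?_
        rw [if_neg (by have := (mem_Ico.1 hj).2; omega)]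
    · simp only [monomial]
      rw [← mul_assoc, ← prod_mul_distrib]
      congr 2
      refine prod_congr rfl fun k _ => ?_
      rw [hIcc, prod_Ico_succ_top hi'.2, pow_one]

/-- All coordinates are 1/2: sums and doubled coordinates are 1, differences vanish. -/
lemma hasMonomialPath_B_spin (hn : 1 ≤ n) : HasMonomialPath .B n n := by
  let pa : ℕ → ℕ → ℕ := fun _ j => if j = n then 1 else 0
  let lam : ℕ → ℚ := fun l => if l ≤ n then 1 / 2 else 0
  refine ⟨pa, fun _ _ => 1, lam, _, coordPath_genWord_BC (Or.inl rfl)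
    (fun l hl => if_neg (by omega)) (fun k j h1 h2 h3 => ?_) (fun k j h1 h2 h3 => ?_)
    (fun hB k h1 h2 => ?_) (fun hC => by simp at hC), fun l hl => ?_, fun l hl => ?_,
    fun a b => ?_⟩
  · simp only [lam]
    rw [if_pos (by omega), if_pos (by omega)]
    norm_num
  · simp only [pa, lam]
    rw [if_neg (by omega), if_pos (by omega), if_pos (by omega)]
    norm_num
  · simp only [pa, lam, if_true]
    rw [if_pos h2]
    norm_num
  · have hl' := mem_Icc.1 hl
    simp only [pairing, lam]
    split_ifs <;> first | (exfalso; omega) | norm_num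
  · have hl' := mem_Icc.1 hl
    simp only [pairing, insertAt, lam, Nat.not_lt_zero, if_false, show l ≠ 0 by omega,
      show n ≠ 0 by omega, show l + 1 ≠ 0 by omega]
    split_ifs <;> first | (exfalso; omega) | norm_num
  · have h1 : ∏ k ∈ Icc 1 n, ∏ j ∈ Ico k n, a k j ^ pa k j = 1 := by
      refine prod_eq_one fun k _ => prod_eq_one fun j hj => ?_
      simp only [pa]
      rw [if_neg (mem_Ico.1 hj).2.ne, pow_zero]
    rw [prod_genWord_BC (Or.inl rfl) fun t : ℂ × ℕ => t.1 ^ t.2]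
    simp only [h1, one_mul, pow_one]
    simp only [monomial, pa, if_true, lt_irrefl, if_false, pow_one]
    rw [← prod_mul_distrib]
    refine prod_congr rfl fun k hk => ?_
    rw [show Icc k n = Ico k (n + 1) from rfl, prod_Ico_succ_top (mem_Icc.1 hk).2, if_pos rfl,
      prod_congr rfl fun j hj => if_neg (mem_Ico.1 hj).2.ne, mul_comm]

lemma hasMonomialPath_D_vector (hi : i ∈ Icc 1 n) (hin : i + 2 ≤ n) : HasMonomialPath .D n i := by
  have hi' := mem_Icc.1 hi
  let pa : ℕ → ℕ → ℕ := fun k j => if k ≤ i ∧ i ≤ j then 1 else 0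
  let pb : ℕ → ℕ → ℕ := fun k j => (if k ≤ i then 1 else 0) + if j + 1 ≤ i then 1 else 0
  let lam : ℕ → ℚ := fun l => if l ≤ i then 1 else 0
  have hlamn : lam n = 0 := if_neg (by omega)
  refine ⟨pa, pb, lam, _, coordPath_genWord_D (by omega)
    (fun l hl => if_neg (by omega)) (fun k j h1 h2 h3 => ?_) (fun k j h1 h2 h3 => ?_)
    (fun k h1 h2 => ?_) (fun k h1 h2 => ?_), fun l hl => ?_, fun l hl => ?_, fun a b => ?_⟩
  · simp only [pb, lam]
    push_cast
    rfl
  · simp only [pa, lam]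
    split_ifs <;> first | (exfalso; omega) | norm_num
  · rw [hlamn]
    simp only [pb, lam]
    split_ifs <;> first | (exfalso; omega) | norm_num
  · rw [hlamn]
    simp only [pa, lam]
    split_ifs <;> first | (exfalso; omega) | norm_num
  · have hl' := mem_Icc.1 hl
    simp only [pairing, lam]
    split_ifs <;> first | (exfalso; omega) | norm_num
  · have hl' := mem_Icc.1 hl
    rw [hlamn]
    simp only [pairing, insertAt, lam, Nat.not_lt_zero, if_false, show l ≠ 0 by omega,
      show n ≠ 0 by omega, show l + 1 ≠ 0 by omega, show n - 1 ≠ 0 by omega]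
    split_ifs <;> first | (exfalso; omega) | norm_num
  · rw [prod_genWord_D fun t : ℂ × ℕ => t.1 ^ t.2]
    simp only [pa, pb]
    rw [prod_pow_ite (by omega), prod_bar_pow (by omega) hi'.2]
    simp only [monomial, if_pos hin]
    rw [← mul_assoc, ← prod_mul_distrib]
    congr 1
    exact prod_congr rfl fun k _ => prod_mul_distrib.symm

lemma hasMonomialPath_D_spin (hn : 2 ≤ n) (hi : i = n ∨ i + 1 = n) : HasMonomialPath .D n i := by
  -- This says that the last coordinate is +1/2 before block k. Then the letter with label n has
  -- exponent 1 and the one with label n - 1 has exponent 0; otherwise it is the other way round.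
  let s : ℕ → Prop := fun k => Even (n - 1 - k) ↔ i = n
  let pa : ℕ → ℕ → ℕ := fun k j => if j = n - 1 ∧ ¬ s k then 1 else 0
  let pb : ℕ → ℕ → ℕ := fun k j => if j = n - 1 ∧ ¬ s k then 0 else 1
  let ε : ℚ := if i = n then 1 / 2 else -1 / 2
  let lam : ℕ → ℚ := fun l => if l < n then 1 / 2 else if l = n then ε else 0
  have hlamn : lam n = ε := by simp [lam]
  have hlam (k : ℕ) (hk : k < n) : lam k = 1 / 2 := if_pos hk
  have hε (k : ℕ) : lastSign n k * ε = if s k then 1 / 2 else -1 / 2 := by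
    simp only [lastSign, ε, s]
    by_cases h1 : Even (n - 1 - k) <;> by_cases h2 : i = n <;> simp [h1, h2]
    all_goals norm_num
  refine ⟨pa, pb, lam, _, coordPath_genWord_D hn
    (fun l hl => by simp only [lam]; rw [if_neg (by omega), if_neg (by omega)])
    (fun k j h1 h2 h3 => ?_) (fun k j h1 h2 h3 => ?_)
    (fun k h1 h2 => ?_) (fun k h1 h2 => ?_), fun l hl => ?_, fun l hl => ?_, fun a b => ?_⟩
  · rw [hlam k (by omega), hlam (j + 1) (by omega)]
    simp only [pb]
    rw [if_neg (by omega)]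
    norm_num
  · rw [hlam k (by omega), hlam (j + 1) (by omega)]
    simp only [pa]
    rw [if_neg (by omega)]
    norm_num
  · rw [hlam k (by omega), hlamn, hε]
    simp only [pb, true_and]
    by_cases hs : s k <;> simp [hs] <;> norm_num
  · rw [hlam k (by omega), hlamn, hε]
    simp only [pa, true_and]
    by_cases hs : s k <;> simp [hs] <;> norm_num
  · have hl' := mem_Icc.1 hl
    simp only [pairing, lam, ε]
    split_ifs <;> first | (exfalso; omega) | norm_num
  · have hl' := mem_Icc.1 hl
    rw [hlamn, hε]
    simp only [pairing, insertAt, lam, Nat.not_lt_zero, if_false, show l ≠ 0 by omega,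
      show n ≠ 0 by omega, show l + 1 ≠ 0 by omega, show n - 1 ≠ 0 by omega]
    split_ifs <;> first | (exfalso; omega) | norm_num
  · rw [prod_genWord_D fun t : ℂ × ℕ => t.1 ^ t.2]
    have hI : Icc 1 (n - 1) = Ico 1 n := by ext; simp only [mem_Icc, mem_Ico]; omega
    have h1 : ∏ k ∈ Ico 1 n, ∏ j ∈ Ico k n, a k j ^ pa k j =
        ∏ k ∈ Ico 1 n, if s k then 1 else a k (n - 1) := by
      refine prod_congr rfl fun k hk => ?_
      have hk' := mem_Ico.1 hk
      have h4 : ∏ j ∈ Ico k n, a k j ^ pa k j =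
          (∏ j ∈ Ico k (n - 1), a k j ^ pa k j) * a k (n - 1) ^ pa k (n - 1) := by
        rw [← prod_Ico_succ_top (by omega), Nat.sub_add_cancel (by omega)]
      rw [h4, prod_eq_one, one_mul]
      · by_cases hs : s k <;> simp [pa, hs]
      · intro j hj
        have hj' := mem_Ico.1 hj
        simp only [pa]
        rw [if_neg (by omega), pow_zero]
    have h2 : ∏ k ∈ Ico 1 n, ∏ j ∈ Ico k n, b k j ^ pb k j =
        (∏ k ∈ Ico 1 (n - 1), ∏ j ∈ Ico k (n - 1), b k j) *
          ∏ k ∈ Ico 1 n, if s k then b k (n - 1) else 1 := by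
      have h3 : ∏ k ∈ Ico 1 (n - 1), ∏ j ∈ Ico k (n - 1), b k j =
          ∏ k ∈ Ico 1 n, ∏ j ∈ Ico k (n - 1), b k j := by
        refine (prod_eq_of_subset (Ico_subset_Ico_right (by omega)) (fun _ _ => rfl)
          fun k hk hk' => ?_).symm
        simp only [mem_Ico] at hk hk'
        rw [Ico_eq_empty (by omega), prod_empty]
      rw [h3, ← prod_mul_distrib]
      refine prod_congr rfl fun k hk => ?_
      have hk' := mem_Ico.1 hk
      have h4 : ∏ j ∈ Ico k n, b k j ^ pb k j =
          (∏ j ∈ Ico k (n - 1), b k j ^ pb k j) * b k (n - 1) ^ pb k (n - 1) := by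
        rw [← prod_Ico_succ_top (by omega), Nat.sub_add_cancel (by omega)]
      rw [h4]
      congr 1
      · refine prod_congr rfl fun j hj => ?_
        have hj' := mem_Ico.1 hj
        simp only [pb]
        rw [if_neg (by omega), pow_one]
      · by_cases hs : s k <;> simp [pb, hs]
    simp only [hI, h1, h2]
    simp only [monomial]
    rw [if_neg (by omega), mul_left_comm, ← prod_mul_distrib]
    -- The sign alternates with k, starting from ε at k = n - 1. This translates it into the parity
    -- of k used in the monomial.
    have hpar (k : ℕ) (hk : k ∈ Ico 1 n) :
        s k ↔ (Odd k ↔ ¬((i + 1 = n ∧ Even n) ∨ (i = n ∧ Odd n))) := by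
      have hk' := mem_Ico.1 hk
      simp only [s, Nat.even_iff, Nat.odd_iff]
      omega
    split_ifs with hc
    · congr 1
      refine prod_congr rfl fun k hk => ?_
      have h5 := hpar k hk
      by_cases ho : Odd k <;> by_cases hs : s k <;> simp_all
    · congr 1
      refine prod_congr rfl fun k hk => ?_
      have h5 := hpar k hk
      by_cases ho : Odd k <;> by_cases hs : s k <;> simp_all

lemma hasMonomialPath {X : ClassicalType} (hn : X = .D → 2 ≤ n) (hi : i ∈ Icc 1 n) :
    HasMonomialPath X n i := by
  have hi' := mem_Icc.1 hi
  cases X with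
  | A => exact hasMonomialPath_A hi
  | B =>
    rcases hi'.2.lt_or_eq with h | rfl
    · exact hasMonomialPath_BC (Or.inl ⟨rfl, rfl, h⟩) hi
    · exact hasMonomialPath_B_spin hi'.1
  | C => exact hasMonomialPath_BC (Or.inr ⟨rfl, rfl⟩) hi
  | D =>
    rcases Nat.lt_or_ge n (i + 2) with h | h
    · exact hasMonomialPath_D_spin (hn rfl) (by omega)
    · exact hasMonomialPath_D_vector hi h

end Exponents

/-! ### From modules over 𝔤 to operator families and paths -/

section Main

variable {X : ClassicalType} {n : ℕ} {V : Type*} [AddCommGroup V] [Module ℂ V]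
  [LieRingModule (𝔤 X n) V] [LieModule ℂ (𝔤 X n) V]

lemma fundamentalWeight_eq (i : Node n) :
    fundamentalWeight i = fun j => ((Pi.single i 1 : Node n → ℕ) j : ℂ) := by
  ext j
  by_cases hij : j = i
  · subst hij; simp [fundamentalWeight]
  · simp [fundamentalWeight, hij]

lemma highestWeightRep [LieModule.IsIrreducible ℂ (𝔤 X n) V] (hn : X = .D → 2 ≤ n)
    {lam : Node n → ℕ} {u : V} (hu : IsHighestWeightVector X (fun j => (lam j : ℂ)) u) :
    HighestWeightRep (cartanMatrix X n) (eOp X n V) (fOp X n V) (hOp X n V)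
      (fun j => rootLength X n j) lam u where
  toChevalleyRep := chevalleyRep_module
  irreducible P he hf hh hP := submodule_eq_top P he hf hh hP
  u_ne_zero := hu.ne_zero
  h_u := hu.weight
  e_u := hu.e_eq_zero
  serre := serre_iterate_eq_zero (LieModule.toEnd ℂ (𝔤 X n) V)
  nondegenerate := cartanMatrix_nondegenerate hn
  diag i := cartanEntry_self X n i
  d_pos i := rootLength_pos X n i
  d_symm i j := rootLength_mul_cartanEntry X (Finset.mem_Icc.1 i.2).2 (Finset.mem_Icc.1 j.2).2

lemma mem_Icc_of_mem_genWord {α : Type*} (hn : X = .D → 2 ≤ n) {a b : ℕ → ℕ → α} {t : ℕ × α}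
    (ht : t ∈ genWord X n a b) : t.1 ∈ Finset.Icc 1 n := by
  cases X <;>
    simp only [genWord, upTo, List.mem_flatMap, List.mem_map, List.mem_reverse, List.mem_append,
      List.mem_range'_1, List.mem_singleton] at ht
  · obtain ⟨k, hk, j, hj, rfl⟩ := ht
    exact Finset.mem_Icc.2 ⟨by omega, by omega⟩
  · obtain ⟨k, hk, ⟨j, hj, rfl⟩ | ⟨j, hj, rfl⟩⟩ := ht <;>
    exact Finset.mem_Icc.2 ⟨by omega, by omega⟩
  · obtain ⟨k, hk, ⟨j, hj, rfl⟩ | ⟨j, hj, rfl⟩⟩ := ht <;>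
    exact Finset.mem_Icc.2 ⟨by omega, by omega⟩
  · have := hn rfl
    obtain ⟨k, hk, (⟨j, hj, rfl⟩ | rfl) | ⟨j, hj, rfl⟩⟩ := ht <;>
    exact Finset.mem_Icc.2 ⟨by omega, by omega⟩

lemma yWord_map_eq {T : Type*} (lab : ℕ → Node n) (hlab : ∀ j ∈ Finset.Icc 1 n, (lab j : ℕ) = j)
    (l : List T) (label : T → ℕ) (c : T → ℂ) (hl : ∀ t ∈ l, label t ∈ Finset.Icc 1 n) (u : V) :
    yWord X n (l.map fun t => (label t, c t)) u =
      l.foldr (fun t z => expOp (fOp X n V (lab (label t))) (c t) z) u := by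
  induction l with
  | nil => rfl
  | cons t l ih =>
    have h1 := hl t List.mem_cons_self
    have h2 : lab (label t) = ⟨label t, h1⟩ := Subtype.ext (hlab _ h1)
    rw [List.foldr_cons, ← ih fun t ht => hl t (List.mem_cons_of_mem _ ht), h2, List.map_cons]
    change y X n (label t) (c t) _ = _
    rw [y, dif_pos h1]
    rfl

end Main

end ClassicalCrystal

end

open ClassicalCrystal

theorem proposition6p1 (X : ClassicalCrystal.ClassicalType) (n : ℕ)
    (hn : X = ClassicalCrystal.ClassicalType.D → 2 ≤ n) (i : ClassicalCrystal.Node n)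
    {V : Type*} [AddCommGroup V] [Module ℂ V]
    [LieRingModule (ClassicalCrystal.𝔤 X n) V] [LieModule ℂ (ClassicalCrystal.𝔤 X n) V]
    [LieModule.IsIrreducible ℂ (ClassicalCrystal.𝔤 X n) V] (u : V)
    (hu : ClassicalCrystal.IsHighestWeightVector X (ClassicalCrystal.fundamentalWeight i) u) :
    (∃! B : LinearMap.BilinForm ℂ V,
      ClassicalCrystal.IsInvariantForm X (ClassicalCrystal.fundamentalWeight i) u B) ∧
    ∀ B : LinearMap.BilinForm ℂ V,
      ClassicalCrystal.IsInvariantForm X (ClassicalCrystal.fundamentalWeight i) u B →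
      ∃ v : V, ClassicalCrystal.IsNormalizedLowest X n B v ∧
        (∀ v' : V, ClassicalCrystal.IsNormalizedLowest X n B v' → v' = v ∨ v' = -v) ∧
        ∀ a b : ℕ → ℕ → ℂ,
          B (ClassicalCrystal.yWord X n (ClassicalCrystal.longestWord X n a b) u) v =
            ClassicalCrystal.monomial X n i a b := by
  rw [fundamentalWeight_eq] at hu ⊢
  have R := highestWeightRep hn hu
  refine ⟨existsUnique_form R, fun B hB => ?_⟩
  have hc := isContravariant_of_isInvariantForm R hB
  obtain ⟨pa, pb, x, x', hpath, hx, hx', hprod⟩ := hasMonomialPath hn i.2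
  -- The value outside the range 1, ..., n is arbitrary; no letter of the word has such a label.
  let lab : ℕ → Node n := fun j => if hj : j ∈ Finset.Icc 1 n then ⟨j, hj⟩ else i
  have hlab (j : ℕ) (hj : j ∈ Finset.Icc 1 n) : (lab j : ℕ) = j := by simp only [lab, dif_pos hj]
  obtain ⟨μ, hμ, hw⟩ := hpath.weightPath hn
    (lam := fun j => ((Pi.single i 1 : Node n → ℕ) j : ℤ)) (fun l => by
      rw [hx l l.2]
      by_cases hl : l = i
      · subst hl; simp
      · simp [hl, Subtype.coe_injective.ne hl]) lab hlab
  have hμ0 (j : Node n) : μ j ≤ 0 := by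
    have h1 := hx' j j.2
    rw [← hμ] at h1
    exact_mod_cast h1
  obtain ⟨m, -, hext⟩ := R.isExtremal_dividedWord hw
  have hf := R.f_dividedWord hw hμ0
  have hself := R.apply_self_dividedWord hc hw
  -- The normalized vector is the last extremal vector of the path. It depends only on the exponents
  -- and is fixed before the coordinates `a`, `b` are introduced.
  refine ⟨_, ⟨⟨hext.ne_zero, ⟨_, hext.weight⟩, hf⟩, hself⟩, fun v' hv' => ?_, fun a b => ?_⟩
  · obtain ⟨⟨hv0, ⟨ν, hν⟩, hfv⟩, hv1⟩ := hv'
    obtain ⟨c, rfl⟩ := R.exists_smul_of_lowest hext.weight hf hext.ne_zero hν hfv hv0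
    rw [map_smul B, LinearMap.smul_apply, map_smul, hself, smul_eq_mul, smul_eq_mul, mul_one,
      mul_self_eq_one_iff] at hv1
    rcases hv1 with rfl | rfl
    · exact Or.inl (one_smul _ _)
    · exact Or.inr (neg_one_smul _ _)
  -- Each letter carries its coordinate together with its exponent, so that the group element and
  -- the weight path are two projections of one list.
  · let l := genWord X n (fun k j => (a k j, pa k j)) (fun k j => (b k j, pb k j))
    have h1 : longestWord X n a b = l.map fun t => (t.1, t.2.1) := by
      rw [longestWord_eq]
      exact (map_genWord (Prod.fst : ℂ × ℕ → ℂ) X n (fun k j => (a k j, pa k j))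
        (fun k j => (b k j, pb k j))).symm
    have h2 : (genWord X n pa pb).map (fun t => (lab t.1, t.2)) =
        l.map fun t => (lab t.1, t.2.2) := by
      rw [← map_genWord (α := ℂ × ℕ) Prod.snd X n (fun k j => (a k j, pa k j))
        (fun k j => (b k j, pb k j)), List.map_map]
      rfl
    rw [h2] at hw ⊢
    rw [h1, yWord_map_eq lab hlab l _ _ fun t ht => mem_Icc_of_mem_genWord hn ht, ← hprod a b]
    exact (R.exp_word_apply hc l (fun t => lab t.1) (fun t => t.2.2) (fun t => t.2.1) hw).2
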